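/- Fix a relational signature, and let $\mathfrak{F}$ be a class of finite structures for it. Throughout, an embedding is an injection that preserves and reflects all relations. Given embeddings $i\colon X\to Y$ and $j\colon X\to X'$ of structures, an *amalgamation* of $Y$ and $X'$ over $X$ is a structure $Y'\in\mathfrak{F}$ with embeddings $i'\colon X'\to Y'$ and $j'\colon Y\to Y'$ such that $i'j=j'i$ and $Y'=\operatorname{im}(i')\cup\operatorname{im}(j')$; amalgamations are considered up to isomorphisms compatible with $i'$ and $j'$. Assume that $\mathfrak{F}$ is a *Fraïssé class*: it has finitely many isomorphism classes of $n$-element structures for each $n$; if $X\in\mathfrak{F}$ and $Y$ embeds into $X$ then $Y\in\mathfrak{F}$; and any two embeddings $X\to Y$, $X\to X'$ in $\mathfrak{F}$ have at least one amalgamation. Disjoint subsets $A,B$ of $X\in\mathfrak{F}$ are *separated* if $X$ is the unique amalgamation of $X\setminus A$ and $X\setminus B$ over $X\setminus(A\cup B)$. A *marked structure* is a pair $(X,x)$ with $X\in\mathfrak{F}$ and $x\in X$; it is *minimal* if no $y\in X\setminus\{x\}$ is such that $\{y\}$ and $\{x\}$ are separated. A *measure* on $\mathfrak{F}$ valued in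 a commutative ring $k$ assigns to each embedding $i\colon X\to Y$ in $\mathfrak{F}$ an element $\mu(i)\in k$ such that: (a) $\mu(i)=1$ if $i$ is an isomorphism; (b) $\mu(j\circ i)=\mu(j)\mu(i)$ for composable embeddings; (c) for embeddings $i\colon X\to Y$ and $j\colon X\to X'$ in $\mathfrak{F}$ with amalgamations $(Y'_\alpha,i'_\alpha,j'_\alpha)$, $1\le\alpha\le n$ (one from each isomorphism class), $\mu(i)=\sum_{\alpha=1}^n\mu(i'_\alpha)$. The measure is *regular* if every $\mu(i)$ is a unit of $k$. The class $\mathfrak{F}$ is *odd* if for all embeddings $X\to Y$ and $X\to Z$ in $\mathfrak{F}$ the number of amalgamations of $Y$ and $Z$ over $X$ is odd. **Theorem.** Suppose that $\mathfrak{F}$ has only finitely many minimal marked structures up to isomorphism, and that $m$ is an odd positive integer such that for every $X\in\mathfrak{F}$ the order of $\operatorname{Aut}(X)$ divides some power of $m$. Let $k$ be a nonzero commutative ring in which $m$ is invertible (for example $k=\mathbf{C}$ or $k=\mathbf{Z}[1/m]$). Then $\mathfrak{F}$ admits a regular measure valued in $k$ if and only if $\mathfrak{F}$ is odd. -/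

import Mathlib

open scoped FirstOrder

universe u v w z

namespace FraisseMeasure

variable {L : FirstOrder.Language.{u, v}}

/-- An amalgamation of `Y` and `Z` over `X`, along embeddings `i : X → Y` and `j : X → Z`: a
structure `pt` in the class `F` with embeddings of `Y` and `Z` that agree on `X` and are jointly
surjective. -/
structure Amalgamation (F : Set (CategoryTheory.Bundled.{w} L.Structure)) {X Y Z : Type w}
    [L.Structure X] [L.Structure Y] [L.Structure Z] (i : X ↪[L] Y) (j : X ↪[L] Z) where
  /-- the amalgamated structure -/
  pt : F
  /-- the embedding of `Y` -/
  inl : Y ↪[L] pt.1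
  /-- the embedding of `Z` -/
  inr : Z ↪[L] pt.1
  comm : inl.comp i = inr.comp j
  cover : Set.range inl ∪ Set.range inr = Set.univ

namespace Amalgamation

variable {F : Set (CategoryTheory.Bundled.{w} L.Structure)} {X Y Z : Type w}
  [L.Structure X] [L.Structure Y] [L.Structure Z] {i : X ↪[L] Y} {j : X ↪[L] Z}

/-- Isomorphism of amalgamations: an isomorphism of structures compatible with both embeddings. -/
def Iso (A B : Amalgamation F i j) : Prop :=
  ∃ e : A.pt.1 ≃[L] B.pt.1, (∀ y, e (A.inl y) = B.inl y) ∧ (∀ z, e (A.inr z) = B.inr z)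

theorem iso_equivalence : Equivalence (Iso (F := F) (i := i) (j := j)) where
  refl A := ⟨FirstOrder.Language.Equiv.refl L _, fun _ => rfl, fun _ => rfl⟩
  symm := by
    rintro A B ⟨e, h1, h2⟩
    refine ⟨e.symm, fun y => ?_, fun y => ?_⟩
    · rw [← h1, FirstOrder.Language.Equiv.symm_apply_apply]
    · rw [← h2, FirstOrder.Language.Equiv.symm_apply_apply]
  trans := by
    rintro A B C ⟨e, h1, h2⟩ ⟨f, g1, g2⟩
    refine ⟨f.comp e, fun y => ?_, fun y => ?_⟩
    · change f (e _) = _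
      rw [h1, g1]
    · change f (e _) = _
      rw [h2, g2]

end Amalgamation

/-- Amalgamations up to isomorphism, as a setoid. -/
def amalgamationSetoid (F : Set (CategoryTheory.Bundled.{w} L.Structure)) {X Y Z : Type w}
    [L.Structure X] [L.Structure Y] [L.Structure Z] (i : X ↪[L] Y) (j : X ↪[L] Z) :
    Setoid (Amalgamation F i j) :=
  ⟨Amalgamation.Iso, Amalgamation.iso_equivalence⟩

/-- The number of amalgamations, counted up to isomorphism. -/
noncomputable def numAmalgamations (F : Set (CategoryTheory.Bundled.{w} L.Structure)) {X Y Z : Type w}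
    [L.Structure X] [L.Structure Y] [L.Structure Z] (i : X ↪[L] Y) (j : X ↪[L] Z) : ℕ :=
  Nat.card (Quotient (amalgamationSetoid F i j))

/-- A Fraïssé class of finite structures. -/
structure IsFraisseClass (F : Set (CategoryTheory.Bundled.{w} L.Structure)) : Prop where
  finite : ∀ X ∈ F, Finite X
  /-- for each `n` there are finitely many `n`-element members up to isomorphism -/
  finite_isoClasses : ∀ n : ℕ, ∃ S : Set (CategoryTheory.Bundled.{w} L.Structure), S.Finite ∧
    ∀ X ∈ F, Nat.card X = n → ∃ Y ∈ S, Nonempty (X ≃[L] Y)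
  hereditary : ∀ X ∈ F, ∀ Y : CategoryTheory.Bundled.{w} L.Structure, Nonempty (Y ↪[L] X) → Y ∈ F
  amalgamation : ∀ X Y Z : F, ∀ (i : X.1 ↪[L] Y.1) (j : X.1 ↪[L] Z.1),
    Nonempty (Amalgamation F i j)

/-- A subset of a structure in a relational language, with the induced structure. -/
def induced [L.IsRelational] {X : Type w} [L.Structure X] (s : Set X) : L.Substructure X where
  carrier := s
  fun_mem f := isEmptyElim f

theorem induced_mono [L.IsRelational] {X : Type w} [L.Structure X] {s t : Set X} (h : s ⊆ t) :
    induced (L := L) s ≤ induced t := h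

/-- Subsets `A` and `B` of `X` (meant to be disjoint) are separated if `X`, with the two
inclusions, is up to isomorphism the only amalgamation of `X ∖ A` and `X ∖ B` over
`X ∖ (A ∪ B)`. -/
def Separated [L.IsRelational] (F : Set (CategoryTheory.Bundled.{w} L.Structure)) {X : Type w} [L.Structure X]
    (A B : Set X) : Prop :=
  ∀ P : Amalgamation F
      (FirstOrder.Language.Substructure.inclusion (induced_mono (L := L)
        (Set.compl_subset_compl.mpr (Set.subset_union_left (s := A) (t := B)))))
      (FirstOrder.Language.Substructure.inclusion (induced_mono (L := L)
        (Set.compl_subset_compl.mpr (Set.subset_union_right (s := A) (t := B))))),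
    ∃ e : X ≃[L] P.pt.1,
      (∀ y : induced (L := L) Aᶜ, e y = P.inl y) ∧ (∀ z : induced (L := L) Bᶜ, e z = P.inr z)

/-- A marked structure: a member of the class with a distinguished point. -/
structure MarkedStructure (F : Set (CategoryTheory.Bundled.{w} L.Structure)) where
  /-- the underlying structure -/
  str : F
  /-- the marked point -/
  point : str.1

namespace MarkedStructure

variable {F : Set (CategoryTheory.Bundled.{w} L.Structure)}

/-- Isomorphism of marked structures. -/
def Iso (M N : MarkedStructure F) : Prop :=
  ∃ e : M.str.1 ≃[L] N.str.1, e M.point = N.point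

/-- An unmarked point is extraneous if it is separated from the marked point. -/
def Extraneous [L.IsRelational] (M : MarkedStructure F) (y : M.str.1) : Prop :=
  y ≠ M.point ∧ Separated F {y} {M.point}

/-- A marked structure is minimal if it has no extraneous points. -/
def IsMinimal [L.IsRelational] (M : MarkedStructure F) : Prop :=
  ∀ y, ¬ M.Extraneous y

end MarkedStructure

/-- There are finitely many minimal marked structures up to isomorphism. -/
def FinitelyManyMinimal [L.IsRelational] (F : Set (CategoryTheory.Bundled.{w} L.Structure)) : Prop :=
  ∃ S : Set (MarkedStructure F), S.Finite ∧
    ∀ M : MarkedStructure F, M.IsMinimal → ∃ N ∈ S, M.Iso N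

/-- The order of the automorphism group of each member of `F` divides some power of `m`. -/
def AutBounded (F : Set (CategoryTheory.Bundled.{w} L.Structure)) (m : ℕ) : Prop :=
  ∀ X ∈ F, ∃ e : ℕ, Nat.card (X ≃[L] X) ∣ m ^ e

/-- A measure on the class `F` with values in the commutative ring `k`. -/
structure Measure (F : Set (CategoryTheory.Bundled.{w} L.Structure)) (k : Type z) [CommRing k] where
  /-- the value of the measure on an embedding of members of `F` -/
  val : ∀ {X Y : F}, (X.1 ↪[L] Y.1) → k
  val_iso : ∀ {X Y : F} (e : X.1 ≃[L] Y.1), val (X := X) (Y := Y) e.toEmbedding = 1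
  val_comp : ∀ {X Y Z : F} (i : X.1 ↪[L] Y.1) (j : Y.1 ↪[L] Z.1),
    val (X := X) (Y := Z) (j.comp i) = val j * val i
  /-- if `A 0, …, A (n - 1)` are the various amalgamations of `Y` and `X'` over `X` (each
  isomorphism class listed exactly once) then the value on `X → Y` is the sum of the values on
  the base changes `X' → A α` -/
  val_amalgamation : ∀ {X Y X' : F} (i : X.1 ↪[L] Y.1) (j : X.1 ↪[L] X'.1) (n : ℕ)
    (A : Fin n → Amalgamation F i j), (∀ B : Amalgamation F i j, ∃! α, B.Iso (A α)) →
      val i = ∑ α, val (X := X') (Y := (A α).pt) (A α).inr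

/-- A measure is regular if all of its values are units. -/
def Measure.IsRegular {F : Set (CategoryTheory.Bundled.{w} L.Structure)} {k : Type z} [CommRing k]
    (μ : Measure F k) : Prop :=
  ∀ {X Y : F} (i : X.1 ↪[L] Y.1), IsUnit (μ.val i)

/-- The class `F` is odd if the number of amalgamations of any two extensions `X → Y` and
`X → Z` in `F` is odd. -/
def IsOddClass (F : Set (CategoryTheory.Bundled.{w} L.Structure)) : Prop :=
  ∀ (X Y Z : F) (i : X.1 ↪[L] Y.1) (j : X.1 ↪[L] Z.1), Odd (numAmalgamations F i j)

end FraisseMeasure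

/-! Fix a prime p not dividing m and an embedding i : X → Y. The amalgamation axiom and
multiplicativity write μ(i)^p as the sum of μ(X → W) over all W glued from p copies of Y over X
(`Weight.IsMeasure.sum_glue`). Rotating the copies acts on these gluings. A fixed gluing carries an
automorphism whose p-th power is trivial; as p does not divide the order of any automorphism group,
that automorphism is trivial and all copies coincide. So μ(i)^p - μ(i) is a sum over free orbits of
size p, that is, p times a sum of values of μ (`Measure.exists_pow_sub_self`). Everything rests on
this identity.

Lifting. If ν is a measure modulo p^n, n ≥ 1, then ν(i)^p minus the sum of ν over the gluings other
than the diagonal is a measure modulo p^(n+1), congruent to ν modulo p^n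
(`Weight.IsMeasureMod.frobLift`). In the limit, an 𝔽_p-valued regular measure lifts to a regular
measure valued in ℚ_p (`Measure.exists_isRegular_padic`).

Integrality. Finiteness of the minimal marked structures makes every value a product of finitely
many values on one-point extensions. At a valuation where p is small, a largest such value of size >
1 would contradict the identity, so all values are integral (`Measure.valuation_le_one`). For a
regular measure they are units satisfying a^(p-1) ≡ 1. For p = 2 all values are therefore ≡ 1, which
yields two facts: the amalgamation axiom reduces to 1 ≡ number of amalgamations, so the class is
odd; and a regular measure is unique (`Measure.val_eq_of_isRegular`).

Regular implies odd. Pass to a residue field of k. In characteristic p the values satisfy a^p = a,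
so they lie in 𝔽_p and lift to ℚ_p; in characteristic zero take a valuation above 2.

Odd implies regular. The constant 1 is a measure modulo 2; lift it to ℚ_2. Its values are integral
at all places above 2, hence algebraic over ℚ, and uniqueness makes them Galois invariant, hence
rational. They are units at every prime not dividing m, so they are units of ℤ[1/m], which maps to
k. -/

namespace FraisseMeasure

open FirstOrder.Language FirstOrder.Language.Structure

/-! ### Quantifier-free types of tuples, which replace structures up to isomorphism -/

section Diagrams

/-- The quantifier-free type of a tuple indexed by `D`: which entries coincide, and which relations
hold between them. -/
@[ext]
structure Diagram (L : FirstOrder.Language.{u, v}) (D : Type w) where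
  /-- coincidence of entries -/
  eqv : Setoid D
  /-- the relations between the entries -/
  rel : ∀ n, L.Relations n → (Fin n → D) → Prop
  rel_congr : ∀ n R (x y : Fin n → D), (∀ i, eqv (x i) (y i)) → rel n R x → rel n R y

variable {L : FirstOrder.Language.{u, v}}

namespace Diagram

variable {D D' D'' P P' : Type w} [L.Structure P] [L.Structure P']

/-- The diagram of a tuple in a structure. -/
def ofMap (g : D → P) : Diagram L D where
  eqv := Setoid.ker g
  rel n R x := RelMap R (g ∘ x)
  rel_congr n R _ _ h hx := by
    have : g ∘ _ = g ∘ _ := funext h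
    rwa [← this]

/-- Reindexing of a diagram. -/
def pullback (δ : Diagram L D) (f : D' → D) : Diagram L D' where
  eqv := δ.eqv.comap f
  rel n R x := δ.rel n R (f ∘ x)
  rel_congr n R _ _ h hx := δ.rel_congr n R _ _ h hx

theorem ofMap_pullback (g : D → P) (f : D' → D) :
    (ofMap (L := L) g).pullback f = ofMap (g ∘ f) := rfl

theorem pullback_congr (δ : Diagram L D) {f g : D' → D} (h : ∀ x, δ.eqv (f x) (g x)) :
    δ.pullback f = δ.pullback g := by
  refine Diagram.ext (Setoid.ext fun a b => ?_) (funext fun n => funext fun R => funext fun x =>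
    propext ?_)
  · change δ.eqv _ _ ↔ δ.eqv _ _
    exact ⟨fun H => δ.eqv.trans (δ.eqv.trans (δ.eqv.symm (h a)) H) (h b),
      fun H => δ.eqv.trans (δ.eqv.trans (h a) H) (δ.eqv.symm (h b))⟩
  · change δ.rel _ _ _ ↔ δ.rel _ _ _
    exact ⟨δ.rel_congr _ _ _ _ fun i => h _, δ.rel_congr _ _ _ _ fun i => δ.eqv.symm (h _)⟩

/-- Embeddings preserve and reflect both equality and relations, so a diagram does not see the
ambient structure. -/
theorem ofMap_comp_embedding (g : D → P) (i : P ↪[L] P') :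
    ofMap (L := L) (i ∘ g) = ofMap g := by
  refine Diagram.ext (Setoid.ext fun a b => ?_) (funext fun n => funext fun R => funext fun x =>
    propext ?_)
  · exact i.injective.eq_iff
  · exact i.map_rel _ (g ∘ _)

/-- The set of entries of a tuple with the given diagram. -/
def Quot (δ : Diagram L D) : Type w := Quotient δ.eqv

/-- The universal tuple with a given diagram. -/
def toQuot (δ : Diagram L D) (x : D) : δ.Quot := Quotient.mk δ.eqv x

theorem toQuot_surjective (δ : Diagram L D) : Function.Surjective δ.toQuot := Quotient.mk_surjective

theorem toQuot_eq_toQuot (δ : Diagram L D) {x y : D} : δ.toQuot x = δ.toQuot y ↔ δ.eqv x y := Quotient.eq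

variable [L.IsRelational]

/-- Relations are read off at chosen representatives; `rel_congr` makes the choice immaterial. -/
instance (δ : Diagram L D) : L.Structure δ.Quot where
  funMap f := isEmptyElim f
  RelMap {n} R x := δ.rel n R (fun i => (x i).out)

theorem ofMap_toQuot (δ : Diagram L D) : ofMap δ.toQuot = δ := by
  refine Diagram.ext (Setoid.ext fun a b => ?_) (funext fun n => funext fun R => funext fun x =>
    propext ?_)
  · exact δ.toQuot_eq_toQuot
  · exact ⟨δ.rel_congr _ _ _ _ fun i => δ.toQuot_eq_toQuot.1 (Quotient.out_eq _),
      δ.rel_congr _ _ _ _ fun i => δ.toQuot_eq_toQuot.1 (Quotient.out_eq _).symm⟩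

/-- Two tuples with the same diagram are matched by an embedding. -/
noncomputable def embOfMap (g : D → P) (g' : D → P') (hg : Function.Surjective g)
    (h : ofMap (L := L) g = ofMap g') : P ↪[L] P' where
  toFun p := g' (Function.surjInv hg p)
  inj' p q hpq := by
    have := (congrArg (fun δ : Diagram L D => δ.eqv (Function.surjInv hg p)
      (Function.surjInv hg q)) h).mpr hpq
    change g _ = g _ at this
    rwa [Function.surjInv_eq hg, Function.surjInv_eq hg] at this
  map_fun' f := isEmptyElim f
  map_rel' {n} R x := by
    have := (congrArg (fun δ : Diagram L D => δ.rel n R (Function.surjInv hg ∘ x)) h)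
    change RelMap R (g ∘ _ ∘ x) = RelMap R (g' ∘ _ ∘ x) at this
    rw [← Function.comp_assoc, (Function.rightInverse_surjInv hg).comp_eq_id,
      Function.id_comp] at this
    exact iff_of_eq this.symm

theorem embOfMap_apply (g : D → P) (g' : D → P') (hg : Function.Surjective g)
    (h : ofMap (L := L) g = ofMap g') (x : D) : embOfMap g g' hg h (g x) = g' x := by
  change g' _ = g' _
  have : g (Function.surjInv hg (g x)) = g x := Function.surjInv_eq hg _
  have h2 := (congrArg (fun δ : Diagram L D => δ.eqv (Function.surjInv hg (g x)) x) h)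
  exact h2.mp this

/-- Two exhaustive tuples with the same diagram are matched by an isomorphism. -/
noncomputable def equivOfMap (g : D → P) (g' : D → P') (hg : Function.Surjective g)
    (hg' : Function.Surjective g') (h : ofMap (L := L) g = ofMap g') : P ≃[L] P' where
  toFun := embOfMap g g' hg h
  invFun := embOfMap g' g hg' h.symm
  left_inv p := by obtain ⟨x, rfl⟩ := hg p; simp only [embOfMap_apply]
  right_inv p := by obtain ⟨x, rfl⟩ := hg' p; simp only [embOfMap_apply]
  map_fun' f := isEmptyElim f
  map_rel' R x := (embOfMap g g' hg h).map_rel R x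

theorem equivOfMap_apply (g : D → P) (g' : D → P') (hg : Function.Surjective g)
    (hg' : Function.Surjective g') (h : ofMap (L := L) g = ofMap g') (x : D) :
    equivOfMap g g' hg hg' h (g x) = g' x := embOfMap_apply g g' hg h x

end Diagram

/-- Diagrams that are realised in members of the class `F`. -/
def FDiagram (F : Set (CategoryTheory.Bundled.{w} L.Structure)) (D : Type w) : Type (max v w) :=
  {δ : Diagram L D // ∃ P : F, ∃ g : D → P.1, Diagram.ofMap g = δ}

namespace FDiagram

variable {F : Set (CategoryTheory.Bundled.{w} L.Structure)} {D D' D'' : Type w}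

/-- Coincidence of entries. -/
def eqv (δ : FDiagram F D) : Setoid D := δ.1.eqv

/-- Reindexing of a diagram. -/
def pullback (δ : FDiagram F D) (f : D' → D) : FDiagram F D' :=
  ⟨δ.1.pullback f, by
    obtain ⟨P, g, h⟩ := δ.2
    exact ⟨P, g ∘ f, by rw [← h]; rfl⟩⟩

/-- The diagram of a tuple in a member of the class. -/
def ofMap (P : F) (g : D → P.1) : FDiagram F D := ⟨Diagram.ofMap g, P, g, rfl⟩

@[simp]
theorem pullback_pullback (δ : FDiagram F D) (f : D' → D) (g : D'' → D') :
    (δ.pullback f).pullback g = δ.pullback (f ∘ g) := rfl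

@[simp]
theorem pullback_id (δ : FDiagram F D) : δ.pullback id = δ := rfl

theorem ofMap_pullback (P : F) (g : D → P.1) (f : D' → D) :
    (ofMap P g).pullback f = ofMap P (g ∘ f) := rfl

theorem ofMap_eqv (P : F) (g : D → P.1) (x y : D) : (ofMap P g).eqv x y ↔ g x = g y := Iff.rfl

theorem pullback_congr (δ : FDiagram F D) {f g : D' → D} (h : ∀ x, δ.eqv (f x) (g x)) :
    δ.pullback f = δ.pullback g := Subtype.ext (δ.1.pullback_congr h)

theorem pullback_eq_self (δ : FDiagram F D) {f : D → D} (h : ∀ x, δ.eqv (f x) x) :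
    δ.pullback f = δ := δ.pullback_congr (g := id) h

theorem eqv_refl (δ : FDiagram F D) (x : D) : δ.eqv x x := δ.eqv.refl x

theorem eqv_of_eq (δ : FDiagram F D) {x y : D} (h : x = y) : δ.eqv x y := h ▸ δ.eqv.refl x

theorem eqv_symm (δ : FDiagram F D) {x y : D} (h : δ.eqv x y) : δ.eqv y x := δ.eqv.symm h

theorem eqv_trans (δ : FDiagram F D) {x y t : D} (h : δ.eqv x y) (h' : δ.eqv y t) : δ.eqv x t :=
  δ.eqv.trans h h'

variable [L.IsRelational] [hF : Fact (IsFraisseClass F)]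

/-- The quotient structure of a realised diagram embeds into the structure that realises it, so
heredity puts it in `F`. -/
theorem exists_surjective (δ : FDiagram F D) :
    ∃ (P : F) (g : D → P.1), Function.Surjective g ∧ ofMap P g = δ := by
  obtain ⟨δ, P, g, h⟩ := δ
  refine ⟨⟨⟨δ.Quot, inferInstance⟩, ?_⟩, δ.toQuot, δ.toQuot_surjective, Subtype.ext δ.ofMap_toQuot⟩
  exact hF.out.hereditary P.1 P.2 _
    ⟨Diagram.embOfMap δ.toQuot g δ.toQuot_surjective (δ.ofMap_toQuot.trans h.symm)⟩

/-- The structure in `F` consisting of the entries of a tuple with the given diagram. -/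
noncomputable def str (δ : FDiagram F D) : F := δ.exists_surjective.choose

/-- The universal tuple with the given diagram. -/
noncomputable def mk (δ : FDiagram F D) : D → δ.str.1 := δ.exists_surjective.choose_spec.choose

theorem mk_surjective (δ : FDiagram F D) : Function.Surjective δ.mk :=
  δ.exists_surjective.choose_spec.choose_spec.1

theorem ofMap_mk (δ : FDiagram F D) : ofMap δ.str δ.mk = δ :=
  δ.exists_surjective.choose_spec.choose_spec.2

theorem ofMap_mk_val (δ : FDiagram F D) : Diagram.ofMap δ.mk = δ.1 :=
  congrArg Subtype.val δ.ofMap_mk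

theorem mk_eq_mk (δ : FDiagram F D) {x y : D} : δ.mk x = δ.mk y ↔ δ.eqv x y := by
  conv_rhs => rw [← δ.ofMap_mk]
  rfl

instance finite_str (X : F) : Finite X.1 := hF.out.finite _ X.2

/-- An exhaustive tuple generates a structure with at most as many points as `D`. Such structures
form finitely many isomorphism classes, each with finitely many tuples. -/
instance [Finite D] : Finite (FDiagram F D) := by
  choose S hS hS' using hF.out.finite_isoClasses
  -- The sets `S n` may contain infinite structures, which have to be discarded for the set of
  -- tuples to be finite.
  let T : Set (CategoryTheory.Bundled.{w} L.Structure) :=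
    {Y | Finite Y ∧ Y ∈ ⋃ n ∈ Finset.range (Nat.card D + 1), S n}
  have hT : T.Finite := (Set.Finite.biUnion (Finset.finite_toSet _) fun n _ => hS n).subset
    fun Y hY => hY.2
  have : Finite T := hT
  have hTf (Y : T) : Finite Y.1 := Y.2.1
  refine Set.Finite.subset (s := Set.range fun x : (Σ Y : T, (D → Y.1)) =>
    Diagram.ofMap (L := L) x.2) (Set.finite_range _) ?_ |>.to_subtype
  rintro δ hδ
  obtain ⟨P, g, hg, h⟩ := exists_surjective (⟨δ, hδ⟩ : FDiagram F D)
  obtain ⟨Y, hY, ⟨e⟩⟩ := hS' _ P.1 P.2 rfl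
  refine ⟨⟨⟨Y, Finite.of_equiv _ e.toEquiv, ?_⟩, e ∘ g⟩, ?_⟩
  · simp only [Set.mem_iUnion]
    exact ⟨_, Finset.mem_range.2 (Nat.lt_succ_of_le (Nat.card_le_card_of_surjective g hg)), hY⟩
  · exact (Diagram.ofMap_comp_embedding g e.toEmbedding).trans (congrArg Subtype.val h)

noncomputable instance [Finite D] : Fintype (FDiagram F D) := Fintype.ofFinite _

end FDiagram

end Diagrams

end FraisseMeasure

set_option linter.unusedSectionVars false

namespace FraisseMeasure

open FirstOrder.Language FirstOrder.Language.Structure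

/-! ### Measures as functions of diagrams -/

section Weights

open scoped Classical in
/-- The joint diagrams of two tuples with given diagrams, sharing prescribed entries. -/
noncomputable def amals {L : FirstOrder.Language.{u, v}} [L.IsRelational]
    {F : Set (CategoryTheory.Bundled.{w} L.Structure)} [Fact (IsFraisseClass F)]
    {A B C : Type w} [Finite A] [Finite B] (f : C → A) (g : C → B)
    (α : FDiagram F A) (β : FDiagram F B) : Finset (FDiagram F (A ⊕ B)) :=
  Finset.univ.filter fun ε => ε.pullback Sum.inl = α ∧ ε.pullback Sum.inr = β ∧
    ∀ c, ε.eqv (Sum.inl (f c)) (Sum.inr (g c))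

/-- A function of pairs consisting of a tuple in a member of `F` and a subtuple that depends only
on the structure generated by the tuple and the substructure generated by the subtuple. -/
structure Weight {L : FirstOrder.Language.{u, v}}
    (F : Set (CategoryTheory.Bundled.{w} L.Structure)) (R : Type z) where
  /-- the value on the subtuple along `f` of a tuple with diagram `δ` -/
  val : ∀ {E D : Type w} [Finite E] [Finite D], (E → D) → FDiagram F D → R
  -- The three conditions say, up to coincidence of entries, that `e` is exhaustive and that the two
  -- subtuples have the same set of entries.
  val_congr : ∀ {E D E' D' : Type w} [Finite E] [Finite D] [Finite E'] [Finite D']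
    (f : E → D) (f' : E' → D') (e : D' → D) (δ : FDiagram F D),
    (∀ y, ∃ x, δ.eqv (e x) y) → (∀ x', ∃ x, δ.eqv (f x) (e (f' x'))) →
    (∀ x, ∃ x', δ.eqv (f x) (e (f' x'))) → val f' (δ.pullback e) = val f δ

variable {L : FirstOrder.Language.{u, v}} [L.IsRelational]
  {F : Set (CategoryTheory.Bundled.{w} L.Structure)} [hF : Fact (IsFraisseClass F)]
  {R : Type z} [CommRing R]

namespace Weight

/-- The axioms of a measure, for a weight. -/
structure IsMeasure (ν : Weight F R) : Prop where
  one : ∀ {E D : Type w} [Finite E] [Finite D] (f : E → D) (δ : FDiagram F D),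
    (∀ y, ∃ x, δ.eqv (f x) y) → ν.val f δ = 1
  mul : ∀ {E D H : Type w} [Finite E] [Finite D] [Finite H] (f : E → D) (g : D → H)
    (δ : FDiagram F H), ν.val (g ∘ f) δ = ν.val g δ * ν.val f (δ.pullback g)
  amal : ∀ {A B C : Type w} [Finite A] [Finite B] [Finite C] (f : C → A) (g : C → B)
    (α : FDiagram F A) (β : FDiagram F B), α.pullback f = β.pullback g →
    ν.val f α = ∑ ε ∈ amals f g α β, ν.val (Sum.inr : B → A ⊕ B) ε

theorem val_congr_map (ν : Weight F R) {E D : Type w} [Finite E] [Finite D] {f g : E → D}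
    (δ : FDiagram F D) (h : ∀ x, δ.eqv (f x) (g x)) : ν.val f δ = ν.val g δ :=
  ν.val_congr g f id δ (fun y => ⟨y, δ.eqv_refl _⟩) (fun x => ⟨x, δ.eqv_symm (h x)⟩)
    fun x => ⟨x, δ.eqv_symm (h x)⟩

end Weight

namespace Measure

variable (μ : Measure F R)

theorem val_eq_of_equiv {X Y X' Y' : F} (i : X.1 ↪[L] Y.1) (i' : X'.1 ↪[L] Y'.1)
    (e : X.1 ≃[L] X'.1) (e' : Y.1 ≃[L] Y'.1) (h : ∀ x, i' (e x) = e' (i x)) :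
    μ.val (X := X) (Y := Y) i = μ.val (X := X') (Y := Y') i' := by
  have h1 := μ.val_comp (X := X) (Y := X') (Z := Y') e.toEmbedding i'
  have h2 := μ.val_comp (X := X) (Y := Y) (Z := Y') i e'.toEmbedding
  have h3 : i'.comp e.toEmbedding = e'.toEmbedding.comp i := by
    ext x
    exact h x
  rw [h3, h2, μ.val_iso, μ.val_iso, one_mul, mul_one] at h1
  exact h1

theorem ofMap_mk_pullback {E D : Type w} (f : E → D) (δ : FDiagram F D) :
    Diagram.ofMap (δ.pullback f).mk = Diagram.ofMap (L := L) (δ.mk ∘ f) := by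
  rw [FDiagram.ofMap_mk_val, ← Diagram.ofMap_pullback, FDiagram.ofMap_mk_val]
  rfl

/-- The value of a measure on the structures generated by a tuple and a subtuple. -/
noncomputable def evalMap {E D : Type w} (f : E → D) (δ : FDiagram F D) : R :=
  μ.val (X := (δ.pullback f).str) (Y := δ.str)
    (Diagram.embOfMap (δ.pullback f).mk (δ.mk ∘ f) (δ.pullback f).mk_surjective
      (ofMap_mk_pullback f δ))

theorem evalMap_eq {E D : Type w} (f : E → D) {X Y : F} (i : X.1 ↪[L] Y.1) (a : E → X.1)
    (b : D → Y.1) (ha : Function.Surjective a) (hb : Function.Surjective b)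
    (h : ∀ x, b (f x) = i (a x)) : μ.evalMap f (FDiagram.ofMap Y b) = μ.val (X := X) (Y := Y) i := by
  set δ := FDiagram.ofMap Y b
  have h1 : Diagram.ofMap (L := L) (δ.pullback f).mk = Diagram.ofMap a := by
    rw [FDiagram.ofMap_mk_val, ← Diagram.ofMap_comp_embedding a i]
    exact congrArg Diagram.ofMap (funext h)
  have h2 : Diagram.ofMap (L := L) δ.mk = Diagram.ofMap b := FDiagram.ofMap_mk_val _
  refine μ.val_eq_of_equiv _ i
    (Diagram.equivOfMap _ a (FDiagram.mk_surjective _) ha h1)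
    (Diagram.equivOfMap _ b (FDiagram.mk_surjective _) hb h2) fun x => ?_
  obtain ⟨x, rfl⟩ := (δ.pullback f).mk_surjective x
  rw [Diagram.equivOfMap_apply, Diagram.embOfMap_apply, Function.comp_apply,
    Diagram.equivOfMap_apply, h]

/-- The weight that a measure defines. -/
noncomputable def toWeight : Weight F R where
  val f δ := μ.evalMap f δ
  val_congr {E D E' D'} _ _ _ _ f f' e δ he h1 h2 := by
    choose s hs using h1
    have hpb : (δ.pullback e).pullback f' = (δ.pullback f).pullback s :=
      δ.pullback_congr fun x => δ.eqv_symm (hs x)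
    have key : δ.pullback e = FDiagram.ofMap δ.str (δ.mk ∘ e) := by
      rw [← FDiagram.ofMap_pullback, FDiagram.ofMap_mk]
    rw [key]
    refine μ.evalMap_eq f' _ ((δ.pullback f).mk ∘ s) (δ.mk ∘ e) ?_ ?_ ?_
    · intro x
      obtain ⟨x, rfl⟩ := (δ.pullback f).mk_surjective x
      obtain ⟨y, hy⟩ := h2 x
      exact ⟨y, (δ.pullback f).mk_eq_mk.2 (δ.eqv_trans (hs y) (δ.eqv_symm hy))⟩
    · intro x
      obtain ⟨x, rfl⟩ := δ.mk_surjective x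
      obtain ⟨y, hy⟩ := he x
      exact ⟨y, δ.mk_eq_mk.2 hy⟩
    · intro x
      rw [Function.comp_apply, Function.comp_apply, Diagram.embOfMap_apply, Function.comp_apply,
        FDiagram.mk_eq_mk]
      exact δ.eqv_symm (hs x)

theorem toWeight_eq {E D : Type w} [Finite E] [Finite D] (f : E → D) {X Y : F} (i : X.1 ↪[L] Y.1)
    (a : E → X.1) (b : D → Y.1) (ha : Function.Surjective a) (hb : Function.Surjective b)
    (h : ∀ x, b (f x) = i (a x)) :
    μ.toWeight.val f (FDiagram.ofMap Y b) = μ.val (X := X) (Y := Y) i :=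
  μ.evalMap_eq f i a b ha hb h

theorem toWeight_embedding {X Y : F} (i : X.1 ↪[L] Y.1) :
    μ.toWeight.val i (FDiagram.ofMap Y id) = μ.val (X := X) (Y := Y) i :=
  μ.toWeight_eq i i id id Function.surjective_id Function.surjective_id fun _ => rfl

end Measure

/-- The embedding that matches the structures generated by a subtuple and by a tuple. -/
noncomputable def FDiagram.emb {E D : Type w} (f : E → D) (δ : FDiagram F D)
    (γ : FDiagram F E) (h : γ = δ.pullback f) : γ.str.1 ↪[L] δ.str.1 :=
  Diagram.embOfMap γ.mk (δ.mk ∘ f) γ.mk_surjective (by rw [h, Measure.ofMap_mk_pullback])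

theorem FDiagram.emb_mk {E D : Type w} (f : E → D) (δ : FDiagram F D)
    (γ : FDiagram F E) (h : γ = δ.pullback f) (x : E) : emb f δ γ h (γ.mk x) = δ.mk (f x) :=
  Diagram.embOfMap_apply _ _ _ _ _

theorem Measure.toWeight_emb (μ : Measure F R) {E D : Type w} [Finite E] [Finite D] (f : E → D)
    (δ : FDiagram F D) (γ : FDiagram F E) (h : γ = δ.pullback f) :
    μ.toWeight.val f δ = μ.val (X := γ.str) (Y := δ.str) (FDiagram.emb f δ γ h) := by
  subst h; rfl

/-! ### Isomorphism classes of amalgamations as joint diagrams -/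

section amalgamation

variable {A B C : Type w} [Finite A] [Finite B] [Finite C] (f : C → A) (g : C → B)
    (α : FDiagram F A) (β : FDiagram F B)

/-- The joint diagram of an amalgamation. -/
def Amalgamation.diagram {X Y Z : Type w} [L.Structure X] [L.Structure Y] [L.Structure Z]
    {i : X ↪[L] Y} {j : X ↪[L] Z} (a : A → Y) (b : B → Z) (P : Amalgamation F i j) :
    FDiagram F (A ⊕ B) :=
  FDiagram.ofMap P.pt (Sum.elim (P.inl ∘ a) (P.inr ∘ b))

theorem Amalgamation.elim_surjective {X Y Z : Type w} [L.Structure X] [L.Structure Y] [L.Structure Z]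
    {i : X ↪[L] Y} {j : X ↪[L] Z} {a : A → Y} {b : B → Z} (ha : Function.Surjective a)
    (hb : Function.Surjective b) (P : Amalgamation F i j) :
    Function.Surjective (Sum.elim (P.inl ∘ a) (P.inr ∘ b)) := by
  intro x
  rcases (Set.ext_iff.1 P.cover x).2 trivial with ⟨y, rfl⟩ | ⟨y, rfl⟩
  · obtain ⟨y, rfl⟩ := ha y
    exact ⟨Sum.inl y, rfl⟩
  · obtain ⟨y, rfl⟩ := hb y
    exact ⟨Sum.inr y, rfl⟩

/-- Since the two images cover an amalgamation, a compatible isomorphism is forced on all points and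
exists exactly when the joint tuples have equal diagrams. -/
theorem Amalgamation.iso_iff_diagram_eq {X Y Z : Type w} [L.Structure X] [L.Structure Y]
    [L.Structure Z] {i : X ↪[L] Y} {j : X ↪[L] Z} {a : A → Y} {b : B → Z}
    (ha : Function.Surjective a) (hb : Function.Surjective b) (P Q : Amalgamation F i j) :
    P.Iso Q ↔ P.diagram a b = Q.diagram a b := by
  constructor
  · rintro ⟨e, h1, h2⟩
    refine Subtype.ext ((Diagram.ofMap_comp_embedding _ e.toEmbedding).symm.trans ?_)
    congr 1
    funext x
    rcases x with x | x
    · exact h1 _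
    · exact h2 _
  · intro h
    have h' := congrArg Subtype.val h
    refine ⟨Diagram.equivOfMap _ _ (P.elim_surjective ha hb) (Q.elim_surjective ha hb) h', ?_, ?_⟩
    · intro y
      obtain ⟨y, rfl⟩ := ha y
      exact Diagram.equivOfMap_apply _ _ _ _ h' (Sum.inl y)
    · intro y
      obtain ⟨y, rfl⟩ := hb y
      exact Diagram.equivOfMap_apply _ _ _ _ h' (Sum.inr y)

theorem Amalgamation.diagram_mem {X : Type w} {Y Z : F} [L.Structure X]
    {i : X ↪[L] Y.1} {j : X ↪[L] Z.1} {a : A → Y.1} {b : B → Z.1} {c : C → X}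
    (hf : ∀ x, a (f x) = i (c x)) (hg : ∀ x, b (g x) = j (c x)) (P : Amalgamation F i j) :
    P.diagram a b ∈ amals f g (FDiagram.ofMap Y a) (FDiagram.ofMap Z b) := by
  simp only [amals, Finset.mem_filter, Finset.mem_univ, true_and]
  refine ⟨Subtype.ext (Diagram.ofMap_comp_embedding a P.inl),
    Subtype.ext (Diagram.ofMap_comp_embedding b P.inr), fun x => ?_⟩
  refine (FDiagram.ofMap_eqv _ _ _ _).2 ?_
  simp only [Sum.elim_inl, Sum.elim_inr, Function.comp_apply, hf, hg]
  exact congrArg (fun k : X ↪[L] P.pt.1 => k (c x)) P.comm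

theorem Amalgamation.exists_diagram_eq {X : Type w} {Y Z : F} [L.Structure X]
    {i : X ↪[L] Y.1} {j : X ↪[L] Z.1} {a : A → Y.1} {b : B → Z.1} {c : C → X}
    (ha : Function.Surjective a) (hb : Function.Surjective b) (hc : Function.Surjective c)
    (hf : ∀ x, a (f x) = i (c x)) (hg : ∀ x, b (g x) = j (c x)) (ε : FDiagram F (A ⊕ B))
    (hε : ε ∈ amals f g (FDiagram.ofMap Y a) (FDiagram.ofMap Z b)) :
    ∃ P : Amalgamation F i j, P.pt = ε.str ∧ P.diagram a b = ε := by
  simp only [amals, Finset.mem_filter, Finset.mem_univ, true_and] at hε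
  obtain ⟨h1, h2, h3⟩ := hε
  have h1' : Diagram.ofMap (L := L) a = Diagram.ofMap (ε.mk ∘ Sum.inl) :=
    ((congrArg Subtype.val h1).symm).trans
      (congrArg (fun δ : Diagram L (A ⊕ B) => δ.pullback Sum.inl) ε.ofMap_mk_val.symm)
  have h2' : Diagram.ofMap (L := L) b = Diagram.ofMap (ε.mk ∘ Sum.inr) :=
    ((congrArg Subtype.val h2).symm).trans
      (congrArg (fun δ : Diagram L (A ⊕ B) => δ.pullback Sum.inr) ε.ofMap_mk_val.symm)
  refine ⟨⟨ε.str, Diagram.embOfMap a _ ha h1', Diagram.embOfMap b _ hb h2', ?_, ?_⟩, rfl, ?_⟩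
  · ext x
    obtain ⟨x, rfl⟩ := hc x
    rw [Embedding.comp_apply, Embedding.comp_apply, ← hf, ← hg, Diagram.embOfMap_apply,
      Diagram.embOfMap_apply, Function.comp_apply, Function.comp_apply, FDiagram.mk_eq_mk]
    exact h3 x
  · refine Set.eq_univ_of_forall fun x => ?_
    obtain ⟨x | x, rfl⟩ := ε.mk_surjective x
    · exact Or.inl ⟨a x, Diagram.embOfMap_apply _ _ ha h1' _⟩
    · exact Or.inr ⟨b x, Diagram.embOfMap_apply _ _ hb h2' _⟩
  · refine Eq.trans ?_ ε.ofMap_mk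
    refine congrArg (FDiagram.ofMap ε.str) (funext ?_)
    rintro (x | x)
    · exact Diagram.embOfMap_apply _ _ ha h1' _
    · exact Diagram.embOfMap_apply _ _ hb h2' _

end amalgamation

/-- The finite set `amals` meets every isomorphism class of amalgamations exactly once, so the
amalgamation axiom becomes a sum over a set of diagrams. -/
theorem Measure.toWeight_isMeasure (μ : Measure F R) : μ.toWeight.IsMeasure where
  one {E D} _ _ f δ h := by
    conv_lhs => rw [← δ.ofMap_mk]
    rw [μ.toWeight_eq (X := δ.str) f (FirstOrder.Language.Equiv.refl L _).toEmbedding (δ.mk ∘ f) δ.mk ?_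
      δ.mk_surjective (fun _ => rfl)]
    · exact μ.val_iso _
    · intro y
      obtain ⟨y, rfl⟩ := δ.mk_surjective y
      obtain ⟨x, hx⟩ := h y
      exact ⟨x, δ.mk_eq_mk.2 hx⟩
  mul {E D H} _ _ _ f g δ := by
    rw [μ.toWeight_emb g δ _ rfl, μ.toWeight_emb f (δ.pullback g) _ rfl, ← μ.val_comp]
    conv_lhs => rw [← δ.ofMap_mk]
    refine μ.toWeight_eq _ _ ((δ.pullback g).pullback f).mk _ (FDiagram.mk_surjective _)
      δ.mk_surjective fun x => ?_
    rw [Embedding.comp_apply, FDiagram.emb_mk, FDiagram.emb_mk]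
    rfl
  amal {A B C} _ _ _ f g α β h := by
    set γ := α.pullback f with hγ
    have hf (x : C) : α.mk (f x) = FDiagram.emb f α γ rfl (γ.mk x) :=
      (FDiagram.emb_mk _ _ _ _ _).symm
    have hg (x : C) : β.mk (g x) = FDiagram.emb g β γ h (γ.mk x) :=
      (FDiagram.emb_mk _ _ _ _ _).symm
    have ex (ε : FDiagram F (A ⊕ B)) (hε : ε ∈ amals f g α β) :=
      Amalgamation.exists_diagram_eq f g α.mk_surjective β.mk_surjective γ.mk_surjective hf hg ε
        (by rwa [FDiagram.ofMap_mk, FDiagram.ofMap_mk])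
    choose P hP1 hP2 using ex
    let e := (amals f g α β).equivFin
    rw [μ.toWeight_emb f α γ rfl, μ.val_amalgamation _ (FDiagram.emb g β γ h)
      (amals f g α β).card (fun n => P (e.symm n).1 (e.symm n).2) ?_]
    · rw [← Finset.sum_coe_sort (amals f g α β), ← Equiv.sum_comp e.symm]
      refine Finset.sum_congr rfl fun n _ => ?_
      conv_rhs => rw [← hP2 _ (e.symm n).2]
      refine (μ.toWeight_eq _ _ β.mk _ β.mk_surjective
        (Amalgamation.elim_surjective α.mk_surjective β.mk_surjective _) fun x => ?_).symm
      rfl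
    · intro Q
      have hQ := Q.diagram_mem f g hf hg
      rw [FDiagram.ofMap_mk, FDiagram.ofMap_mk] at hQ
      refine ⟨e ⟨_, hQ⟩, ?_, fun n hn => ?_⟩
      · beta_reduce
        rw [Amalgamation.iso_iff_diagram_eq α.mk_surjective β.mk_surjective, hP2]
        simp
      · beta_reduce at hn
        rw [Amalgamation.iso_iff_diagram_eq α.mk_surjective β.mk_surjective, hP2] at hn
        rw [← e.symm_apply_eq.1 (Subtype.ext hn.symm)]

/-- A weight that satisfies the axioms defines a measure. -/
def Weight.IsMeasure.toMeasure {ν : Weight F R} (h : ν.IsMeasure) : Measure F R where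
  val {_ Y} i := ν.val i (FDiagram.ofMap Y id)
  val_iso {_ _} e := h.one _ _ fun y => ⟨e.symm y, e.apply_symm_apply y⟩
  val_comp {X Y Z} i j := by
    refine (h.mul i j _).trans (congrArg₂ _ rfl (congrArg _ ?_))
    exact Subtype.ext (Diagram.ofMap_comp_embedding _ _)
  val_amalgamation {X Y X'} i j n A hA := by
    have hi : (FDiagram.ofMap Y id).pullback i = FDiagram.ofMap X id :=
      Subtype.ext (Diagram.ofMap_comp_embedding _ _)
    have hj : (FDiagram.ofMap X' id).pullback j = FDiagram.ofMap X id :=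
      Subtype.ext (Diagram.ofMap_comp_embedding _ _)
    have hYs : Function.Surjective (id : Y.1 → Y.1) := Function.surjective_id
    have hXs : Function.Surjective (id : X'.1 → X'.1) := Function.surjective_id
    rw [h.amal i j _ (FDiagram.ofMap X' id) (hi.trans hj.symm)]
    symm
    refine Finset.sum_bij (fun n _ => (A n).diagram id id) (fun n _ => ?_) (fun n _ n' _ hn => ?_)
      (fun ε hε => ?_) (fun n _ => ?_)
    · exact Amalgamation.diagram_mem (c := id) i j (fun _ => rfl) (fun _ => rfl) (A n)
    · rw [← Amalgamation.iso_iff_diagram_eq hYs hXs] at hn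
      exact (hA (A n)).unique (Amalgamation.iso_equivalence.refl _) hn
    · obtain ⟨P, -, hP⟩ := Amalgamation.exists_diagram_eq (c := id) i j hYs hXs
        Function.surjective_id (fun _ => rfl) (fun _ => rfl) ε hε
      obtain ⟨n, hn, -⟩ := hA P
      refine ⟨n, Finset.mem_univ _, ?_⟩
      rw [← hP, (Amalgamation.iso_iff_diagram_eq hYs hXs _ _).1 hn]
    · refine (ν.val_congr (E := X'.1) (D := (A n).pt.1) (E' := X'.1) (D' := Y.1 ⊕ X'.1)
        (A n).inr Sum.inr
        (Sum.elim (A n).inl (A n).inr) (FDiagram.ofMap (A n).pt id)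
        (fun y => ?_) (fun x => ⟨x, rfl⟩) (fun x => ⟨x, rfl⟩)).symm
      exact Amalgamation.elim_surjective hYs hXs (A n) y

end Weights

end FraisseMeasure

namespace FraisseMeasure

open FirstOrder.Language FirstOrder.Language.Structure

/-! ### Sums invariant under a free action of a cyclic group of prime order -/

section Rotation

/-- A sum of a function that is invariant under a permutation of prime order without fixed points
is divisible by that prime. -/
theorem exists_sum_eq_smul_of_iterate_eq_id {α : Type*} {R : Type*} [AddCommMonoid R] {p : ℕ}
    (hp : p.Prime) {σ : α → α} (hσ : σ^[p] = id) (f : α → R) (N : AddSubmonoid R) (S : Finset α)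
    (hS : ∀ x ∈ S, σ x ∈ S) (hfix : ∀ x ∈ S, σ x ≠ x) (hf : ∀ x ∈ S, f (σ x) = f x)
    (hN : ∀ x ∈ S, f x ∈ N) : ∃ s ∈ N, ∑ x ∈ S, f x = p • s := by
  classical
  induction S using Finset.strongInduction with
  | H S ih =>
    rcases S.eq_empty_or_nonempty with rfl | ⟨x, hx⟩
    · exact ⟨0, N.zero_mem, by simp⟩
    have hper : Function.IsPeriodicPt σ p x := by
      change σ^[p] x = x
      rw [hσ]; rfl
    have hmin : Function.minimalPeriod σ x = p := by
      refine ((Nat.dvd_prime hp).1 hper.minimalPeriod_dvd).resolve_left fun h => ?_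
      exact hfix x hx (Function.minimalPeriod_eq_one_iff_isFixedPt.1 h)
    have hit (k : ℕ) : σ^[k] x ∈ S ∧ f (σ^[k] x) = f x := by
      induction k with
      | zero => exact ⟨hx, rfl⟩
      | succ k ihk =>
        rw [Function.iterate_succ_apply']
        exact ⟨hS _ ihk.1, (hf _ ihk.1).trans ihk.2⟩
    set O := (Finset.range p).image fun k => σ^[k] x with hO
    have hOS : O ⊆ S := by
      intro y hy
      obtain ⟨k, -, rfl⟩ := Finset.mem_image.1 hy
      exact (hit k).1
    have hxO : x ∈ O := Finset.mem_image.2 ⟨0, Finset.mem_range.2 hp.pos, rfl⟩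
    have hOsum : ∑ y ∈ O, f y = p • f x := by
      rw [hO, Finset.sum_image]
      · rw [Finset.sum_congr rfl fun k _ => (hit k).2]
        simp
      · intro a ha b hb hab
        refine Function.iterate_injOn_Iio_minimalPeriod (f := σ) (x := x) ?_ ?_ hab
        · rw [hmin]; simpa using ha
        · rw [hmin]; simpa using hb
    obtain ⟨s, hs, hs'⟩ := ih (S \ O)
      (Finset.sdiff_ssubset hOS ⟨x, hxO⟩)
      (fun y hy => by
        rw [Finset.mem_sdiff] at hy ⊢
        refine ⟨hS y hy.1, fun h => hy.2 ?_⟩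
        obtain ⟨k, hk, hk'⟩ := Finset.mem_image.1 h
        -- The power `p - 1` of `σ` inverts it, so a point whose image lies in the orbit `O` lies in
        -- `O` already; the complement is therefore stable.
        have : y = σ^[(p - 1 + k) % p] x := by
          have h1 : σ^[p - 1] (σ y) = y := by
            rw [← Function.iterate_succ_apply, Nat.succ_eq_add_one, Nat.sub_add_cancel hp.pos, hσ]
            rfl
          rw [← hk', ← Function.iterate_add_apply] at h1
          rw [← hmin, Function.iterate_mod_minimalPeriod_eq, hmin, h1]
        rw [this]
        exact Finset.mem_image.2 ⟨_, Finset.mem_range.2 (Nat.mod_lt _ hp.pos), rfl⟩)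
      (fun y hy => hfix y (Finset.mem_sdiff.1 hy).1) (fun y hy => hf y (Finset.mem_sdiff.1 hy).1)
      (fun y hy => hN y (Finset.mem_sdiff.1 hy).1)
    -- The quotient by `p` contains one value per orbit. This is why it inherits any bound or
    -- divisibility that `N` expresses.
    refine ⟨s + f x, N.add_mem hs (hN x hx), ?_⟩
    rw [← Finset.sum_sdiff hOS, hs', hOsum, smul_add]

theorem finRotate_iterate_self (n : ℕ) : (finRotate n)^[n] = id := by
  rcases n with _ | n
  · rfl
  have h (k : ℕ) (i : Fin (n + 1)) :
      (finRotate (n + 1))^[k] i = ⟨(i + k) % (n + 1), Nat.mod_lt _ n.succ_pos⟩ := by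
    induction k with
    | zero => exact Fin.ext (Nat.mod_eq_of_lt i.2).symm
    | succ k ih =>
      rw [Function.iterate_succ_apply', ih, finRotate_apply]
      refine Fin.ext ?_
      rw [Fin.val_add, Fin.val_one']
      simp [add_assoc]
  funext i
  rw [h]
  exact Fin.ext (by simp [Nat.mod_eq_of_lt i.2])

theorem rel_of_finRotate {n : ℕ} (s : Setoid (Fin n)) (h : ∀ i, s (finRotate n i) i)
    (i j : Fin n) : s i j := by
  rcases n with _ | n
  · exact i.elim0
  have h0 (i : Fin (n + 1)) : s i 0 := by
    induction i using Fin.induction with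
    | zero => exact s.refl _
    | succ i ih =>
      refine s.trans ?_ ih
      have := h i.castSucc
      rwa [finRotate_apply, Fin.coeSucc_eq_succ] at this
  exact s.trans (h0 i) (s.symm (h0 j))

end Rotation

variable {L : FirstOrder.Language.{u, v}} [L.IsRelational]
  {F : Set (CategoryTheory.Bundled.{w} L.Structure)} [hF : Fact (IsFraisseClass F)]

/-- A structure whose automorphism group has order prime to `p` admits no automorphism of
order `p`. -/
theorem apply_eq_self_of_iterate_eq_id {m : ℕ} (haut : AutBounded F m) {p : ℕ} (hp : p.Prime)
    (hpm : ¬ p ∣ m) (X : F) (τ : X.1 ≃[L] X.1) (hτ : ∀ x, (τ^[p]) x = x) (x : X.1) : τ x = x := by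
  -- Automorphisms are regarded as a group of permutations, so that the order of an element divides
  -- the order of the group.
  let H : Subgroup (Equiv.Perm X.1) :=
    { carrier := Set.range fun e : X.1 ≃[L] X.1 => e.toEquiv
      mul_mem' := by
        rintro _ _ ⟨e, rfl⟩ ⟨e', rfl⟩
        exact ⟨e.comp e', rfl⟩
      one_mem' := ⟨FirstOrder.Language.Equiv.refl L _, rfl⟩
      inv_mem' := by
        rintro _ ⟨e, rfl⟩
        exact ⟨e.symm, rfl⟩ }
  have hinj : Function.Injective fun e : X.1 ≃[L] X.1 => e.toEquiv := by
    intro e e' h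
    exact FirstOrder.Language.Equiv.ext fun x => congrArg (fun f : Equiv.Perm X.1 => f x) h
  have hcard : Nat.card (X.1 ≃[L] X.1) = Nat.card H :=
    Nat.card_congr (Equiv.ofInjective _ hinj)
  obtain ⟨e, he⟩ := haut X.1 X.2
  rw [hcard] at he
  let t : H := ⟨τ.toEquiv, τ, rfl⟩
  have ht : t ^ p = 1 := by
    refine Subtype.ext (Equiv.ext fun x => ?_)
    rw [Subgroup.coe_pow, Equiv.Perm.coe_pow]
    exact hτ x
  rcases (Nat.dvd_prime hp).1 (orderOf_dvd_of_pow_eq_one ht) with h | h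
  · rw [orderOf_eq_one_iff] at h
    exact congrArg (fun π : H => π.1 x) h
  · exact absurd (hp.dvd_of_dvd_pow ((h ▸ orderOf_dvd_natCard t).trans he)) hpm

/-- A permutation of the indices that fixes the diagram induces an automorphism of the generated
structure. Its p-th power is trivial, and p is prime to the order of the automorphism group. -/
theorem FDiagram.eqv_of_pullback_eq {m : ℕ} (haut : AutBounded F m) {p : ℕ} (hp : p.Prime)
    (hpm : ¬ p ∣ m) {D : Type w} (δ : FDiagram F D) (σ : D → D) (hσ : σ^[p] = id)
    (h : δ.pullback σ = δ) (x : D) : δ.eqv (σ x) x := by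
  have hsurj : Function.Surjective σ := by
    have : Function.Surjective (σ^[p]) := hσ ▸ Function.surjective_id
    rw [← Nat.sub_add_cancel hp.pos, Function.iterate_succ'] at this
    exact this.of_comp
  have hmk : Diagram.ofMap (L := L) δ.mk = Diagram.ofMap (δ.mk ∘ σ) := by
    rw [← Diagram.ofMap_pullback, δ.ofMap_mk_val]
    exact (congrArg Subtype.val h).symm
  let τ := Diagram.equivOfMap δ.mk (δ.mk ∘ σ) δ.mk_surjective (δ.mk_surjective.comp hsurj) hmk
  have hτ (x : D) : τ (δ.mk x) = δ.mk (σ x) := Diagram.equivOfMap_apply _ _ _ _ hmk x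
  have hit (k : ℕ) (x : D) : τ^[k] (δ.mk x) = δ.mk (σ^[k] x) := by
    induction k with
    | zero => rfl
    | succ k ih => rw [Function.iterate_succ_apply', ih, hτ, Function.iterate_succ_apply']
  rw [← δ.mk_eq_mk, ← hτ]
  refine apply_eq_self_of_iterate_eq_id haut hp hpm δ.str τ (fun y => ?_) _
  obtain ⟨y, rfl⟩ := δ.mk_surjective y
  rw [hit, hσ]
  rfl

theorem FDiagram.pullback_injective {D D' : Type w} {e : D' → D} (he : Function.Surjective e) :
    Function.Injective fun δ : FDiagram F D => δ.pullback e := by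
  intro δ δ' h
  have := congrArg (fun ε => ε.pullback (Function.surjInv he)) h
  simpa only [FDiagram.pullback_pullback, (Function.rightInverse_surjInv he).comp_eq_id,
    FDiagram.pullback_id] using this

/-! ### Gluings of several tuples and their cyclic symmetry -/

section Glue

variable {C D H : Type w} [Finite C] [Finite D] [Finite H]

open scoped Classical in
/-- The diagrams of families of tuples glued onto a common tuple: the `i`-th tuple has diagram
`δ i`, and its entries along `g` are identified with entries of the common tuple along `h i`. -/
noncomputable def glue {n : ℕ} (g : D → H) (h : Fin n → D → C) (δ : Fin n → FDiagram F H)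
    (η : FDiagram F C) : Finset (FDiagram F (C ⊕ Fin n × H)) :=
  Finset.univ.filter fun ε => ε.pullback Sum.inl = η ∧
    (∀ i, ε.pullback (fun x => Sum.inr (i, x)) = δ i) ∧
    ∀ i d, ε.eqv (Sum.inl (h i d)) (Sum.inr (i, g d))

theorem mem_glue {n : ℕ} {g : D → H} {h : Fin n → D → C} {δ : Fin n → FDiagram F H}
    {η : FDiagram F C} {ε : FDiagram F (C ⊕ Fin n × H)} : ε ∈ glue g h δ η ↔
    ε.pullback Sum.inl = η ∧ (∀ i, ε.pullback (fun x => Sum.inr (i, x)) = δ i) ∧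
    ∀ i d, ε.eqv (Sum.inl (h i d)) (Sum.inr (i, g d)) := by
  simp [glue]

theorem mem_amals {A B : Type w} [Finite A] [Finite B] {f : C → A} {g : C → B}
    {α : FDiagram F A} {β : FDiagram F B} {ε : FDiagram F (A ⊕ B)} : ε ∈ amals f g α β ↔
    ε.pullback Sum.inl = α ∧ ε.pullback Sum.inr = β ∧
    ∀ c, ε.eqv (Sum.inl (f c)) (Sum.inr (g c)) := by
  simp [amals]

variable {R : Type z} [CommRing R] {ν : Weight F R}

/-- The tuples are attached one at a time. The amalgamation axiom gives the total mass of the ways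
to attach one more tuple to a partial gluing, and multiplicativity combines it with the mass of the
partial gluing. -/
theorem Weight.IsMeasure.sum_glue (hν : ν.IsMeasure) {n : ℕ} (g : D → H) (h : Fin n → D → C)
    (δ : Fin n → FDiagram F H) (η : FDiagram F C)
    (hδ : ∀ i, (δ i).pullback g = η.pullback (h i)) :
    ∑ ε ∈ glue g h δ η, ν.val (Sum.inl : C → C ⊕ Fin n × H) ε = ∏ i, ν.val g (δ i) := by
  classical
  induction n with
  | zero =>
    let s : C ⊕ Fin 0 × H → C := Sum.elim id fun x => x.1.elim0
    have hs : s ∘ Sum.inl = id := rfl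
    have hs' : Sum.inl ∘ s = id := by
      funext x
      rcases x with x | x
      · rfl
      · exact x.1.elim0
    have : glue g h δ η = {η.pullback s} := by
      ext ε
      rw [mem_glue, Finset.mem_singleton]
      constructor
      · rintro ⟨rfl, -⟩
        rw [FDiagram.pullback_pullback, hs', FDiagram.pullback_id]
      · rintro rfl
        exact ⟨rfl, fun i => i.elim0, fun i => i.elim0⟩
    rw [this, Finset.sum_singleton, Fin.prod_univ_zero]
    refine hν.one _ _ fun y => ?_
    rcases y with y | y
    · exact ⟨y, FDiagram.eqv_refl _ _⟩
    · exact y.1.elim0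
  | succ n ih =>
    let u : C ⊕ Fin n × H → C ⊕ Fin (n + 1) × H := Sum.map id (Prod.map Fin.succ id)
    let s : H ⊕ (C ⊕ Fin n × H) → C ⊕ Fin (n + 1) × H := Sum.elim (fun x => Sum.inr (0, x)) u
    let t : C ⊕ Fin (n + 1) × H → H ⊕ (C ⊕ Fin n × H) := Sum.elim (Sum.inr ∘ Sum.inl)
      fun x => Fin.cases (Sum.inl x.2) (fun j => Sum.inr (Sum.inr (j, x.2))) x.1
    have hst : s ∘ t = id := by
      funext x
      rcases x with x | ⟨i, x⟩
      · rfl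
      · cases i using Fin.cases <;> rfl
    have hts : t ∘ s = id := by
      funext x
      rcases x with x | x | x <;> rfl
    have hmaps : ∀ ε ∈ glue g h δ η, ε.pullback u ∈ glue g (h ∘ Fin.succ) (δ ∘ Fin.succ) η := by
      intro ε hε
      rw [mem_glue] at hε ⊢
      exact ⟨hε.1, fun i => hε.2.1 _, fun i d => hε.2.2 _ d⟩
    -- The gluings that extend a given gluing `κ` of the last `n` tuples are the amalgamations of
    -- the zeroth tuple with `κ`.
    have hfib : ∀ κ ∈ glue g (h ∘ Fin.succ) (δ ∘ Fin.succ) η,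
        ∑ ε ∈ glue g h δ η with ε.pullback u = κ, ν.val u ε = ν.val g (δ 0) := by
      intro κ hκ
      rw [mem_glue] at hκ
      rw [hν.amal g (Sum.inl ∘ h 0) (δ 0) κ]
      · refine Finset.sum_bij' (fun ε _ => ε.pullback s) (fun ε _ => ε.pullback t) ?_ ?_ ?_ ?_ ?_
        · intro ε hε
          rw [Finset.mem_filter, mem_glue] at hε
          rw [mem_amals]
          exact ⟨hε.1.2.1 0, hε.2, fun c => FDiagram.eqv_symm _ (hε.1.2.2 0 c)⟩
        · intro ε hε
          rw [mem_amals] at hε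
          obtain ⟨h1, rfl, h3⟩ := hε
          rw [Finset.mem_filter, mem_glue]
          refine ⟨⟨hκ.1, fun i => ?_, fun i d => ?_⟩, ?_⟩
          · cases i using Fin.cases with
            | zero => exact h1
            | succ i => exact hκ.2.1 i
          · cases i using Fin.cases with
            | zero => exact FDiagram.eqv_symm _ (h3 d)
            | succ i => exact hκ.2.2 i d
          · change ε.pullback ((t ∘ s) ∘ Sum.inr) = _
            rw [hts]
            rfl
        · intro ε _
          rw [FDiagram.pullback_pullback, hst, FDiagram.pullback_id]
        · intro ε _
          rw [FDiagram.pullback_pullback, hts, FDiagram.pullback_id]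
        · intro ε _
          refine (ν.val_congr u Sum.inr s ε (fun y => ⟨t y, ε.eqv_of_eq (congrFun hst y)⟩)
            (fun x => ⟨x, ε.eqv_refl _⟩) (fun x => ⟨x, ε.eqv_refl _⟩)).symm
      · rw [hδ, ← FDiagram.pullback_pullback, hκ.1]
    have hmul : ∀ ε : FDiagram F (C ⊕ Fin (n + 1) × H), ν.val (Sum.inl : C → _) ε =
        ν.val u ε * ν.val (Sum.inl : C → C ⊕ Fin n × H) (ε.pullback u) := fun ε =>
      hν.mul Sum.inl u ε
    have ih' := ih (h ∘ Fin.succ) (δ ∘ Fin.succ) fun i => hδ _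
    simp only [Function.comp_apply] at ih'
    rw [← Finset.sum_fiberwise_of_maps_to hmaps, Fin.prod_univ_succ, ← ih', Finset.mul_sum]
    refine Finset.sum_congr rfl fun κ hκ => ?_
    rw [← hfib κ hκ, Finset.sum_mul]
    refine Finset.sum_congr rfl fun ε hε => ?_
    rw [hmul, (Finset.mem_filter.1 hε).2]

/-- The rotation of the indices of a family of tuples. -/
def rot (C H : Type w) (n : ℕ) : C ⊕ Fin n × H → C ⊕ Fin n × H :=
  Sum.map id (Prod.map (finRotate n) id)

theorem rot_iterate (n k : ℕ) : (rot C H n)^[k] = Sum.map id (Prod.map (finRotate n)^[k] id) := by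
  induction k with
  | zero => simp
  | succ k ih =>
    rw [Function.iterate_succ', ih]
    funext x
    rcases x with x | x
    · rfl
    · rw [Function.iterate_succ']
      rfl

theorem rot_iterate_self (n : ℕ) : (rot C H n)^[n] = id := by
  rw [rot_iterate, finRotate_iterate_self, Prod.map_id, Sum.map_id_id]

theorem pullback_rot_iterate (n : ℕ) :
    (fun ε : FDiagram F (C ⊕ Fin n × H) => ε.pullback (rot C H n))^[n] = id := by
  have h (k : ℕ) (ε : FDiagram F (C ⊕ Fin n × H)) :
      (fun ε : FDiagram F (C ⊕ Fin n × H) => ε.pullback (rot C H n))^[k] ε =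
        ε.pullback (rot C H n)^[k] := by
    induction k with
    | zero => rfl
    | succ k ih =>
      rw [Function.iterate_succ_apply', ih, FDiagram.pullback_pullback, Function.iterate_succ]
  funext ε
  rw [h, rot_iterate_self]
  rfl

theorem rot_surjective (n : ℕ) : Function.Surjective (rot C H n) := by
  rintro (x | ⟨i, x⟩)
  · exact ⟨Sum.inl x, rfl⟩
  · exact ⟨Sum.inr ((finRotate n).symm i, x),
      congrArg (fun j => Sum.inr (j, x)) ((finRotate n).apply_symm_apply i)⟩

theorem val_pullback_rot (ν : Weight F R) {n : ℕ} (ε : FDiagram F (C ⊕ Fin n × H)) :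
    ν.val (Sum.inl : C → C ⊕ Fin n × H) (ε.pullback (rot C H n)) = ν.val Sum.inl ε :=
  ν.val_congr _ _ _ _ (fun y => (rot_surjective n y).imp fun _ h => ε.eqv_of_eq h)
    (fun x => ⟨x, ε.eqv_refl _⟩) (fun x => ⟨x, ε.eqv_refl _⟩)

/-- The diagrams of `n` tuples with diagram `δ` glued along their subtuple along `f`. -/
noncomputable def selfGlue (n : ℕ) {E D : Type w} [Finite E] [Finite D] (f : E → D)
    (δ : FDiagram F D) : Finset (FDiagram F (E ⊕ Fin n × D)) :=
  glue f (fun _ => id) (fun _ => δ) (δ.pullback f)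

/-- The identification of all members of a family. -/
def fold (n : ℕ) {E D : Type w} (f : E → D) : E ⊕ Fin n × D → D := Sum.elim f Prod.snd

variable {E : Type w} [Finite E] {n : ℕ} {f : E → D} {δ : FDiagram F D}

theorem mem_selfGlue {ε : FDiagram F (E ⊕ Fin n × D)} : ε ∈ selfGlue n f δ ↔
    ε.pullback Sum.inl = δ.pullback f ∧ (∀ i, ε.pullback (fun x => Sum.inr (i, x)) = δ) ∧
    ∀ i d, ε.eqv (Sum.inl d) (Sum.inr (i, f d)) := mem_glue

theorem fold_mem_selfGlue : δ.pullback (fold n f) ∈ selfGlue n f δ := by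
  rw [mem_selfGlue]
  exact ⟨rfl, fun i => rfl, fun i d => δ.eqv_refl _⟩

theorem pullback_rot_mem_selfGlue {ε : FDiagram F (E ⊕ Fin n × D)} (hε : ε ∈ selfGlue n f δ) :
    ε.pullback (rot E D n) ∈ selfGlue n f δ := by
  rw [mem_selfGlue] at hε ⊢
  exact ⟨hε.1, fun i => hε.2.1 _, fun i d => hε.2.2 _ _⟩

theorem eq_fold_of_eqv [NeZero n] {ε : FDiagram F (E ⊕ Fin n × D)} (hε : ε ∈ selfGlue n f δ)
    (h : ∀ i j x, ε.eqv (Sum.inr (i, x)) (Sum.inr (j, x))) : ε = δ.pullback (fold n f) := by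
  rw [mem_selfGlue] at hε
  conv_rhs => rw [← hε.2.1 0, FDiagram.pullback_pullback]
  symm
  refine ε.pullback_eq_self ?_
  rintro (x | ⟨i, x⟩)
  · exact ε.eqv_symm (hε.2.2 0 x)
  · exact h _ _ _

theorem fold_pullback_rot : (δ.pullback (fold n f)).pullback (rot E D n) =
    δ.pullback (fold n f) := by
  rw [FDiagram.pullback_pullback]
  refine congrArg _ (funext ?_)
  rintro (x | x) <;> rfl

/-- Invariance under rotation identifies each copy with the next one, because the automorphism that
rotates the copies is trivial. The diagonal is thus the only fixed gluing. -/
theorem eq_fold_of_pullback_rot_eq {m : ℕ} (haut : AutBounded F m) {p : ℕ} (hp : p.Prime)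
    (hpm : ¬ p ∣ m) {ε : FDiagram F (E ⊕ Fin p × D)} (hε : ε ∈ selfGlue p f δ)
    (h : ε.pullback (rot E D p) = ε) : ε = δ.pullback (fold p f) := by
  have : NeZero p := ⟨hp.ne_zero⟩
  have h1 := ε.eqv_of_pullback_eq haut hp hpm _ (rot_iterate_self p) h
  refine eq_fold_of_eqv hε fun i j x => ?_
  exact rel_of_finRotate (ε.eqv.comap fun i => Sum.inr (i, x)) (fun i => h1 (Sum.inr (i, x))) i j

theorem val_fold (ν : Weight F R) [NeZero n] :
    ν.val Sum.inl (δ.pullback (fold n f)) = ν.val f δ :=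
  ν.val_congr _ _ _ _ (fun y => ⟨Sum.inr (0, y), δ.eqv_refl _⟩) (fun x => ⟨x, δ.eqv_refl _⟩)
    (fun x => ⟨x, δ.eqv_refl _⟩)

theorem Weight.IsMeasure.sum_selfGlue (hν : ν.IsMeasure) (n : ℕ) (f : E → D) (δ : FDiagram F D) :
    ∑ ε ∈ selfGlue n f δ, ν.val (Sum.inl : E → E ⊕ Fin n × D) ε = ν.val f δ ^ n := by
  rw [selfGlue, hν.sum_glue f (fun _ => id) (fun _ => δ) (δ.pullback f) fun _ => rfl]
  simp

open scoped Classical in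
/-- The diagrams of `n` tuples with diagram `δ`, not all equal, glued along their subtuple
along `f`. -/
noncomputable def properGlue (n : ℕ) {E D : Type w} [Finite E] [Finite D] (f : E → D)
    (δ : FDiagram F D) : Finset (FDiagram F (E ⊕ Fin n × D)) :=
  (selfGlue n f δ).erase (δ.pullback (fold n f))

/-- The diagonal gluing generates the same structure as a single copy and contributes `ν.val f δ`.
-/
theorem sum_properGlue (ν : Weight F R) [NeZero n] (f : E → D) (δ : FDiagram F D) :
    ∑ ε ∈ properGlue n f δ, ν.val (Sum.inl : E → E ⊕ Fin n × D) ε + ν.val f δ =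
      ∑ ε ∈ selfGlue n f δ, ν.val (Sum.inl : E → E ⊕ Fin n × D) ε := by
  classical
  rw [properGlue, ← Finset.sum_erase_add _ _ fold_mem_selfGlue, val_fold]

theorem pullback_rot_mem_properGlue {ε : FDiagram F (E ⊕ Fin n × D)}
    (hε : ε ∈ properGlue n f δ) : ε.pullback (rot E D n) ∈ properGlue n f δ := by
  classical
  rw [properGlue, Finset.mem_erase] at hε ⊢
  refine ⟨fun h => hε.1 ?_, pullback_rot_mem_selfGlue hε.2⟩
  exact FDiagram.pullback_injective (rot_surjective n) (h.trans fold_pullback_rot.symm)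

/-- Sums over proper gluings of invariant functions are divisible by `p`. -/
theorem exists_sum_properGlue {m : ℕ} (haut : AutBounded F m) {p : ℕ} (hp : p.Prime)
    (hpm : ¬ p ∣ m) (f : E → D) (δ : FDiagram F D) (N : AddSubmonoid R)
    (φ : FDiagram F (E ⊕ Fin p × D) → R)
    (hφ : ∀ ε ∈ properGlue p f δ, φ (ε.pullback (rot E D p)) = φ ε)
    (hN : ∀ ε ∈ properGlue p f δ, φ ε ∈ N) :
    ∃ s ∈ N, ∑ ε ∈ properGlue p f δ, φ ε = p • s := by
  classical
  refine exists_sum_eq_smul_of_iterate_eq_id hp (pullback_rot_iterate p) φ N _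
    (fun ε hε => pullback_rot_mem_properGlue hε) (fun ε hε h => ?_) hφ hN
  rw [properGlue, Finset.mem_erase] at hε
  exact hε.1 (eq_fold_of_pullback_rot_eq haut hp hpm hε.2 h)

end Glue

end FraisseMeasure

namespace FraisseMeasure

open FirstOrder.Language FirstOrder.Language.Structure

variable {L : FirstOrder.Language.{u, v}} [L.IsRelational]
  {F : Set (CategoryTheory.Bundled.{w} L.Structure)} [hF : Fact (IsFraisseClass F)]
  {R : Type z} [CommRing R]

/-! ### Measures modulo an element of the ring -/

section Congruences

/-- The cofactor of a - b in a^p - b^p is ≡ p·a^(p-1) modulo a - b, and p divides a - b because n ≠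
0; so the cofactor supplies the extra factor p. -/
theorem pow_succ_dvd_pow_sub_pow {p n : ℕ} (hn : n ≠ 0) {a b : R} (h : (p : R) ^ n ∣ a - b) :
    (p : R) ^ (n + 1) ∣ a ^ p - b ^ p := by
  rw [← (Commute.all a b).geom_sum₂_mul, pow_succ']
  exact mul_dvd_mul (dvd_geom_sum₂_self ((dvd_pow_self _ hn).trans h)) h

theorem FDiagram.eqv_of_pullback {D E : Type w} {ε : FDiagram F D} {δ : FDiagram F E} {j : E → D}
    (h : ε.pullback j = δ) {x y : E} (hxy : δ.eqv x y) : ε.eqv (j x) (j y) := by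
  subst h; exact hxy

/-- Composition of a weight with a ring homomorphism. -/
def Weight.map (ν : Weight F R) {S : Type*} [CommRing S] (φ : R →+* S) : Weight F S where
  val f δ := φ (ν.val f δ)
  val_congr f f' e δ h1 h2 h3 := congrArg φ (ν.val_congr f f' e δ h1 h2 h3)

/-- The axioms of a measure modulo `q`. -/
def Weight.IsMeasureMod (ν : Weight F R) (q : R) : Prop :=
  (ν.map (Ideal.Quotient.mk (Ideal.span {q}))).IsMeasure

theorem mk_eq_mk_iff_dvd {q a b : R} : Ideal.Quotient.mk (Ideal.span {q}) a =
    Ideal.Quotient.mk (Ideal.span {q}) b ↔ q ∣ a - b := by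
  rw [Ideal.Quotient.mk_eq_mk_iff_sub_mem, Ideal.mem_span_singleton]

theorem Weight.isMeasureMod_of_dvd {ν : Weight F R} {q : R}
    (one : ∀ {E D : Type w} [Finite E] [Finite D] (f : E → D) (δ : FDiagram F D),
      (∀ y, ∃ x, δ.eqv (f x) y) → q ∣ ν.val f δ - 1)
    (mul : ∀ {E D H : Type w} [Finite E] [Finite D] [Finite H] (f : E → D) (g : D → H)
      (δ : FDiagram F H), q ∣ ν.val (g ∘ f) δ - ν.val g δ * ν.val f (δ.pullback g))
    (amal : ∀ {A B C : Type w} [Finite A] [Finite B] [Finite C] (f : C → A) (g : C → B)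
      (α : FDiagram F A) (β : FDiagram F B), α.pullback f = β.pullback g →
      q ∣ ν.val f α - ∑ ε ∈ amals f g α β, ν.val (Sum.inr : B → A ⊕ B) ε) :
    ν.IsMeasureMod q where
  one f δ h := (mk_eq_mk_iff_dvd.2 (one f δ h)).trans (map_one _)
  mul f g δ := (mk_eq_mk_iff_dvd.2 (mul f g δ)).trans (map_mul _ _ _)
  amal f g α β h := (mk_eq_mk_iff_dvd.2 (amal f g α β h)).trans (map_sum _ _ _)

namespace Weight.IsMeasureMod

variable {ν : Weight F R} {q : R} (hν : ν.IsMeasureMod q)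
include hν

theorem one {E D : Type w} [Finite E] [Finite D] (f : E → D) (δ : FDiagram F D)
    (h : ∀ y, ∃ x, δ.eqv (f x) y) : q ∣ ν.val f δ - 1 :=
  mk_eq_mk_iff_dvd.1 ((IsMeasure.one hν f δ h).trans (map_one _).symm)

theorem mul {E D H : Type w} [Finite E] [Finite D] [Finite H] (f : E → D) (g : D → H)
    (δ : FDiagram F H) : q ∣ ν.val (g ∘ f) δ - ν.val g δ * ν.val f (δ.pullback g) :=
  mk_eq_mk_iff_dvd.1 ((IsMeasure.mul hν f g δ).trans (map_mul _ _ _).symm)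

theorem amal {A B C : Type w} [Finite A] [Finite B] [Finite C] (f : C → A) (g : C → B)
    (α : FDiagram F A) (β : FDiagram F B) (h : α.pullback f = β.pullback g) :
    q ∣ ν.val f α - ∑ ε ∈ amals f g α β, ν.val (Sum.inr : B → A ⊕ B) ε :=
  mk_eq_mk_iff_dvd.1 ((IsMeasure.amal hν f g α β h).trans (map_sum _ _ _).symm)

theorem sum_glue {C D H : Type w} [Finite C] [Finite D] [Finite H] {n : ℕ} (g : D → H)
    (h : Fin n → D → C) (δ : Fin n → FDiagram F H) (η : FDiagram F C)
    (hδ : ∀ i, (δ i).pullback g = η.pullback (h i)) :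
    q ∣ ∑ ε ∈ glue g h δ η, ν.val (Sum.inl : C → C ⊕ Fin n × H) ε - ∏ i, ν.val g (δ i) := by
  have := IsMeasure.sum_glue hν g h δ η hδ
  simp only [Weight.map, ← map_sum, ← map_prod] at this
  exact mk_eq_mk_iff_dvd.1 this

theorem sum_selfGlue {E D : Type w} [Finite E] [Finite D] (n : ℕ) (f : E → D)
    (δ : FDiagram F D) :
    q ∣ ∑ ε ∈ selfGlue n f δ, ν.val (Sum.inl : E → E ⊕ Fin n × D) ε - ν.val f δ ^ n := by
  have := hν.sum_glue f (fun _ : Fin n => id) (fun _ => δ) (δ.pullback f) fun _ => rfl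
  simpa [selfGlue] using this

end Weight.IsMeasureMod

end Congruences

/-! ### Lifting a measure from modulus p^n to modulus p^(n+1) -/

section FrobeniusLift

/-- The inverse rotation of the indices of a family of tuples. -/
def rotSymm (C H : Type w) (n : ℕ) : C ⊕ Fin n × H → C ⊕ Fin n × H :=
  Sum.map id (Prod.map (finRotate n).symm id)

theorem pullback_rotSymm_rot {C H : Type w} {n : ℕ} (ε : FDiagram F (C ⊕ Fin n × H)) :
    (ε.pullback (rotSymm C H n)).pullback (rot C H n) = ε := by
  refine ε.pullback_eq_self ?_
  rintro (x | ⟨i, x⟩)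
  · exact ε.eqv_refl _
  · exact ε.eqv_of_eq (congrArg (fun j => Sum.inr (j, x)) ((finRotate n).symm_apply_apply i))

variable {E D H : Type w} [Finite E] [Finite D] [Finite H]

theorem pullback_mem_selfGlue {E' D' : Type w} [Finite E'] [Finite D'] {n : ℕ} {f : E → D}
    {f' : E' → D'} {e : D' → D} {s : E' → E} {δ : FDiagram F D}
    (h : ∀ x, δ.eqv (f (s x)) (e (f' x))) {ε : FDiagram F (E ⊕ Fin n × D)}
    (hε : ε ∈ selfGlue n f δ) :
    ε.pullback (Sum.map s (Prod.map id e)) ∈ selfGlue n f' (δ.pullback e) := by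
  rw [mem_selfGlue] at hε ⊢
  refine ⟨?_, fun i => ?_, fun i x => ?_⟩
  · change (ε.pullback Sum.inl).pullback s = _
    rw [hε.1]
    exact δ.pullback_congr h
  · change (ε.pullback fun x => Sum.inr (i, x)).pullback e = _
    rw [hε.2.1]
  · exact ε.eqv_trans (hε.2.2 i (s x)) (FDiagram.eqv_of_pullback (hε.2.1 i) (h x))

theorem fold_pullback {E' D' : Type w} [Finite E'] [Finite D'] {n : ℕ} {f : E → D}
    {f' : E' → D'} {e : D' → D} {s : E' → E} {δ : FDiagram F D}
    (h : ∀ x, δ.eqv (f (s x)) (e (f' x))) :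
    (δ.pullback (fold n f)).pullback (Sum.map s (Prod.map id e)) =
      (δ.pullback e).pullback (fold n f') := by
  refine δ.pullback_congr ?_
  rintro (x | x)
  · exact h x
  · exact δ.eqv_refl _

/-- Needed for the lifted function to be a weight: proper gluings of two presentations of the same
pair of structures correspond under reindexings that are inverse up to coincidence of entries. -/
theorem sum_properGlue_pullback (ν : Weight F R) (n : ℕ) {E' D' : Type w} [Finite E'] [Finite D']
    (f : E → D) (f' : E' → D') (e : D' → D) (δ : FDiagram F D)
    (he : ∀ y, ∃ x, δ.eqv (e x) y) (h1 : ∀ x', ∃ x, δ.eqv (f x) (e (f' x')))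
    (h2 : ∀ x, ∃ x', δ.eqv (f x) (e (f' x'))) :
    ∑ ε ∈ properGlue n f' (δ.pullback e), ν.val (Sum.inl : E' → E' ⊕ Fin n × D') ε =
    ∑ ε ∈ properGlue n f δ, ν.val (Sum.inl : E → E ⊕ Fin n × D) ε := by
  classical
  choose s hs using h1
  choose t ht using h2
  choose d hd using he
  have hd' : (δ.pullback e).pullback d = δ := δ.pullback_eq_self hd
  have hst (x : E') : (δ.pullback e).eqv (f' (t (s x))) (f' x) :=
    δ.eqv_trans (δ.eqv_symm (ht _)) (hs x)
  have hts (x : E) : δ.eqv (f (s (t x))) (f x) := δ.eqv_trans (hs _) (δ.eqv_symm (ht x))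
  have ht' (x : E) : (δ.pullback e).eqv (f' (t x)) (d (f x)) :=
    δ.eqv_trans (δ.eqv_symm (ht x)) (δ.eqv_symm (hd _))
  have hL (ε : FDiagram F (E ⊕ Fin n × D)) (hε : ε ∈ selfGlue n f δ) :
      (ε.pullback (Sum.map s (Prod.map id e))).pullback (Sum.map t (Prod.map id d)) = ε := by
    rw [mem_selfGlue] at hε
    refine ε.pullback_eq_self ?_
    rintro (x | ⟨i, x⟩)
    · exact FDiagram.eqv_of_pullback hε.1 (hts x)
    · exact FDiagram.eqv_of_pullback (hε.2.1 i) (hd x)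
  have hR (ε : FDiagram F (E' ⊕ Fin n × D')) (hε : ε ∈ selfGlue n f' (δ.pullback e)) :
      (ε.pullback (Sum.map t (Prod.map id d))).pullback (Sum.map s (Prod.map id e)) = ε := by
    rw [mem_selfGlue] at hε
    refine ε.pullback_eq_self ?_
    rintro (x | ⟨i, x⟩)
    · exact FDiagram.eqv_of_pullback hε.1 (hst x)
    · exact FDiagram.eqv_of_pullback (hε.2.1 i) (hd (e x))
  have hfold' : ((δ.pullback e).pullback (fold n f')).pullback (Sum.map t (Prod.map id d)) =
      δ.pullback (fold n f) := by
    rw [fold_pullback ht', hd']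
  symm
  refine Finset.sum_bij' (fun ε _ => ε.pullback (Sum.map s (Prod.map id e)))
    (fun ε _ => ε.pullback (Sum.map t (Prod.map id d))) ?_ ?_ ?_ ?_ ?_
  · intro ε hε
    rw [properGlue, Finset.mem_erase] at hε ⊢
    refine ⟨fun h => hε.1 ?_, pullback_mem_selfGlue hs hε.2⟩
    rw [← hL ε hε.2, h, hfold']
  · intro ε hε
    rw [properGlue, Finset.mem_erase] at hε ⊢
    refine ⟨fun h => hε.1 ?_, ?_⟩
    · rw [← hR ε hε.2, h, fold_pullback hs]
    · have := pullback_mem_selfGlue ht' hε.2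
      rwa [hd'] at this
  · exact fun ε hε => hL ε (Finset.mem_of_mem_erase hε)
  · exact fun ε hε => hR ε (Finset.mem_of_mem_erase hε)
  · intro ε hε
    have hε' := Finset.mem_of_mem_erase hε
    rw [mem_selfGlue] at hε'
    refine (ν.val_congr Sum.inl Sum.inl _ ε ?_ (fun x => ⟨s x, ε.eqv_refl _⟩) fun x => ⟨t x, ?_⟩).symm
    · rintro (x | ⟨i, x⟩)
      · exact ⟨Sum.inl (t x), FDiagram.eqv_of_pullback hε'.1 (hts x)⟩
      · exact ⟨Sum.inr (i, d x), FDiagram.eqv_of_pullback (hε'.2.1 i) (hd x)⟩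
    · exact FDiagram.eqv_of_pullback hε'.1 (δ.eqv_symm (hts x))

/-- If `ν` is a measure modulo `p ^ n` then this is a measure modulo `p ^ (n + 1)`. -/
noncomputable def Weight.frobLift (p : ℕ) (ν : Weight F R) : Weight F R where
  val {E D} _ _ f δ := ν.val f δ ^ p -
    ∑ ε ∈ properGlue p f δ, ν.val (Sum.inl : E → E ⊕ Fin p × D) ε
  val_congr f f' e δ h1 h2 h3 := by
    rw [ν.val_congr f f' e δ h1 h2 h3, sum_properGlue_pullback ν p f f' e δ h1 h2 h3]

theorem Weight.frobLift_val (p : ℕ) (ν : Weight F R) (f : E → D) (δ : FDiagram F D) :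
    (ν.frobLift p).val f δ = ν.val f δ ^ p -
      ∑ ε ∈ properGlue p f δ, ν.val (Sum.inl : E → E ⊕ Fin p × D) ε := rfl

variable {ν : Weight F R} {p n : ℕ}

/-- Modulo `q` the p-th power is the sum over all gluings, so subtracting the proper ones leaves the
diagonal term. -/
theorem Weight.IsMeasureMod.frobLift_sub {q : R} (hν : ν.IsMeasureMod q) (hp : p.Prime)
    (f : E → D) (δ : FDiagram F D) : q ∣ (ν.frobLift p).val f δ - ν.val f δ := by
  have : NeZero p := ⟨hp.ne_zero⟩
  have h := hν.sum_selfGlue p f δ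
  rw [← sum_properGlue] at h
  rw [frobLift_val]
  rw [← dvd_neg]
  convert h using 1
  ring

/-- If the subtuple is exhaustive then all copies coincide and no proper gluings exist. -/
theorem Weight.IsMeasureMod.frobLift_one (hn : n ≠ 0) (hν : ν.IsMeasureMod ((p : R) ^ n))
    (hp : p.Prime) (f : E → D) (δ : FDiagram F D) (h : ∀ y, ∃ x, δ.eqv (f x) y) :
    (p : R) ^ (n + 1) ∣ (ν.frobLift p).val f δ - 1 := by
  classical
  have : NeZero p := ⟨hp.ne_zero⟩
  have hempty : properGlue p f δ = ∅ := by
    refine Finset.eq_empty_of_forall_notMem fun ε hε => ?_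
    rw [properGlue, Finset.mem_erase] at hε
    refine hε.1 (eq_fold_of_eqv hε.2 fun i j x => ?_)
    have h' := mem_selfGlue.1 hε.2
    obtain ⟨y, hy⟩ := h x
    have key (i : Fin p) : ε.eqv (Sum.inl y) (Sum.inr (i, x)) :=
      ε.eqv_trans (h'.2.2 i y) (FDiagram.eqv_of_pullback (h'.2.1 i) hy)
    exact ε.eqv_trans (ε.eqv_symm (key i)) (key j)
  rw [frobLift_val, hempty, Finset.sum_empty, sub_zero]
  simpa using pow_succ_dvd_pow_sub_pow hn (hν.one f δ h)

variable {m : ℕ} (haut : AutBounded F m) (hp : p.Prime) (hpm : ¬ p ∣ m)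
include haut hp hpm

/-- The source of the extra factor p: a termwise congruence of rotation-invariant functions improves
by p on summation, because all orbits have p elements. -/
theorem dvd_sum_properGlue_sub (f : E → D) (δ : FDiagram F D)
    (φ ψ : FDiagram F (E ⊕ Fin p × D) → R)
    (hφ : ∀ ε ∈ properGlue p f δ, φ (ε.pullback (rot E D p)) = φ ε)
    (hψ : ∀ ε ∈ properGlue p f δ, ψ (ε.pullback (rot E D p)) = ψ ε)
    (h : ∀ ε ∈ properGlue p f δ, (p : R) ^ n ∣ φ ε - ψ ε) :
    (p : R) ^ (n + 1) ∣ ∑ ε ∈ properGlue p f δ, φ ε - ∑ ε ∈ properGlue p f δ, ψ ε := by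
  obtain ⟨s, hs, hs'⟩ := exists_sum_properGlue haut hp hpm f δ
    (Ideal.span {(p : R) ^ n}).toAddSubmonoid (φ - ψ)
    (fun ε hε => by simp [hφ ε hε, hψ ε hε])
    (fun ε hε => Ideal.mem_span_singleton.2 (h ε hε))
  rw [← Finset.sum_sub_distrib]
  simp only [Pi.sub_apply] at hs'
  rw [hs', nsmul_eq_mul, pow_succ']
  exact mul_dvd_mul_left _ (Ideal.mem_span_singleton.1 hs)

theorem dvd_sum_properGlue (ν : Weight F R) (f : E → D) (δ : FDiagram F D) :
    (p : R) ∣ ∑ ε ∈ properGlue p f δ, ν.val (Sum.inl : E → E ⊕ Fin p × D) ε := by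
  obtain ⟨s, -, hs'⟩ := exists_sum_properGlue haut hp hpm f δ ⊤
    (fun ε => ν.val (Sum.inl : E → E ⊕ Fin p × D) ε)
    (fun ε _ => val_pullback_rot ν ε) fun _ _ => trivial
  rw [hs', nsmul_eq_mul]
  exact dvd_mul_right _ _

-- The gluings of the large tuples that restrict to `η` arise by attaching p large tuples to `η`,
-- one on each copy; the total mass of these attachments is ν(g)^p.
omit haut hp hpm in
open scoped Classical in
theorem Weight.IsMeasureMod.sum_selfGlue_comp {q : R} (hν : ν.IsMeasureMod q) (f : E → D)
    (g : D → H) (δ : FDiagram F H) (η : FDiagram F (E ⊕ Fin p × D))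
    (hη : η ∈ selfGlue p f (δ.pullback g)) :
    q ∣ ∑ ε ∈ selfGlue p (g ∘ f) δ with ε.pullback (Sum.map id (Prod.map id g)) = η,
      ν.val (Sum.inl : E → E ⊕ Fin p × H) ε -
      ν.val (Sum.inl : E → E ⊕ Fin p × D) η * ν.val g δ ^ p := by
  let u : E ⊕ Fin p × D → E ⊕ Fin p × H := Sum.map id (Prod.map id g)
  let s : (E ⊕ Fin p × D) ⊕ Fin p × H → E ⊕ Fin p × H := Sum.elim u Sum.inr
  let t : E ⊕ Fin p × H → (E ⊕ Fin p × D) ⊕ Fin p × H := Sum.map Sum.inl id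
  have hst : s ∘ t = id := by
    funext x
    rcases x with x | x <;> rfl
  rw [mem_selfGlue] at hη
  have h1 : q ∣ ∑ ε ∈ selfGlue p (g ∘ f) δ with ε.pullback u = η,
      (ν.val (Sum.inl : E → E ⊕ Fin p × H) ε -
        ν.val u ε * ν.val (Sum.inl : E → E ⊕ Fin p × D) η) := by
    refine Finset.dvd_sum fun ε hε => ?_
    rw [← (Finset.mem_filter.1 hε).2]
    exact hν.mul Sum.inl u ε
  have h2 : ∑ ε ∈ selfGlue p (g ∘ f) δ with ε.pullback u = η, ν.val u ε =
      ∑ ε ∈ glue g (fun i d => Sum.inr (i, d)) (fun _ => δ) η,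
        ν.val (Sum.inl : (E ⊕ Fin p × D) → (E ⊕ Fin p × D) ⊕ Fin p × H) ε := by
    refine Finset.sum_bij' (fun ε _ => ε.pullback s) (fun ε _ => ε.pullback t) ?_ ?_ ?_ ?_ ?_
    · intro ε hε
      rw [Finset.mem_filter, mem_selfGlue] at hε
      rw [mem_glue]
      exact ⟨hε.2, hε.1.2.1, fun i d => ε.eqv_refl _⟩
    · intro ε hε
      rw [mem_glue] at hε
      rw [Finset.mem_filter, mem_selfGlue]
      refine ⟨⟨?_, hε.2.1, fun i d => ?_⟩, ?_⟩
      · change (ε.pullback Sum.inl).pullback Sum.inl = _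
        rw [hε.1, hη.1]
        rfl
      · exact ε.eqv_trans (FDiagram.eqv_of_pullback hε.1 (hη.2.2 i d)) (hε.2.2 i (f d))
      · rw [← hε.1]
        refine ε.pullback_congr ?_
        rintro (x | ⟨i, x⟩)
        · exact ε.eqv_refl _
        · exact ε.eqv_symm (hε.2.2 i x)
    · intro ε _
      rw [FDiagram.pullback_pullback, hst, FDiagram.pullback_id]
    · intro ε hε
      rw [mem_glue] at hε
      refine ε.pullback_eq_self ?_
      rintro ((x | ⟨i, x⟩) | x)
      · exact ε.eqv_refl _
      · exact ε.eqv_symm (hε.2.2 i x)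
      · exact ε.eqv_refl _
    · intro ε _
      exact (ν.val_congr u Sum.inl s ε (fun y => ⟨t y, ε.eqv_of_eq (congrFun hst y)⟩)
        (fun x => ⟨x, ε.eqv_refl _⟩) (fun x => ⟨x, ε.eqv_refl _⟩)).symm
  have h3 := hν.sum_glue g (fun (i : Fin p) d => Sum.inr (i, d)) (fun _ => δ) η
    fun i => (hη.2.1 i).symm
  rw [← h2, Finset.prod_const, Finset.card_univ, Fintype.card_fin] at h3
  rw [Finset.sum_sub_distrib, ← Finset.sum_mul] at h1
  have h4 := dvd_add h1 (h3.mul_right (ν.val (Sum.inl : E → E ⊕ Fin p × D) η))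
  convert h4 using 1
  ring

/-- Write a = ν(g), b = ν(f) and N for sums over proper gluings. Proper gluings along g ∘ f split by
their restriction to the middle copies: proper restrictions contribute N_f·a^p, constant ones N_g·b,
both modulo p^(n+1). So the lift at g ∘ f is congruent to a^p·b^p - N_f·a^p - N_g·b, which differs
from (a^p - N_g)(b^p - N_f) by N_g·((b^p - N_f) - b). -/
theorem Weight.IsMeasureMod.frobLift_mul (hn : n ≠ 0) (hν : ν.IsMeasureMod ((p : R) ^ n))
    (f : E → D) (g : D → H) (δ : FDiagram F H) :
    (p : R) ^ (n + 1) ∣ (ν.frobLift p).val (g ∘ f) δ -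
      (ν.frobLift p).val g δ * (ν.frobLift p).val f (δ.pullback g) := by
  classical
  have : NeZero p := ⟨hp.ne_zero⟩
  let u : E ⊕ Fin p × D → E ⊕ Fin p × H := Sum.map id (Prod.map id g)
  have hu {ε : FDiagram F (E ⊕ Fin p × H)} (hε : ε ∈ selfGlue p (g ∘ f) δ) :
      ε.pullback u ∈ selfGlue p f (δ.pullback g) :=
    pullback_mem_selfGlue (f' := f) (e := g) (s := id) (fun x => δ.eqv_refl _) hε
  have hufold : (δ.pullback (fold p (g ∘ f))).pullback u =
      (δ.pullback g).pullback (fold p f) := fold_pullback (f' := f) (e := g) (s := id) fun x => δ.eqv_refl _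
  have hurot : u ∘ rot E D p = rot E H p ∘ u := by
    funext x
    rcases x with x | x <;> rfl
  -- gluings whose restriction along `g` is proper
  have hB : (p : R) ^ (n + 1) ∣
      ∑ ε ∈ properGlue p (g ∘ f) δ with ε.pullback u ∈ properGlue p f (δ.pullback g),
        ν.val (Sum.inl : E → E ⊕ Fin p × H) ε -
      ∑ η ∈ properGlue p f (δ.pullback g),
        ν.val (Sum.inl : E → E ⊕ Fin p × D) η * ν.val g δ ^ p := by
    have heq : ∑ ε ∈ properGlue p (g ∘ f) δ with ε.pullback u ∈ properGlue p f (δ.pullback g),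
        ν.val (Sum.inl : E → E ⊕ Fin p × H) ε = ∑ η ∈ properGlue p f (δ.pullback g),
        ∑ ε ∈ selfGlue p (g ∘ f) δ with ε.pullback u = η,
          ν.val (Sum.inl : E → E ⊕ Fin p × H) ε := by
      rw [← Finset.sum_fiberwise_of_maps_to (fun ε hε => (Finset.mem_filter.1 hε).2)]
      refine Finset.sum_congr rfl fun η hη => Finset.sum_congr ?_ fun _ _ => rfl
      ext ε
      simp only [Finset.mem_filter]
      constructor
      · rintro ⟨⟨h1, -⟩, h2⟩
        exact ⟨Finset.mem_of_mem_erase h1, h2⟩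
      · rintro ⟨h1, rfl⟩
        refine ⟨⟨Finset.mem_erase.2 ⟨?_, h1⟩, hη⟩, rfl⟩
        rintro rfl
        exact (Finset.mem_erase.1 hη).1 hufold
    rw [heq]
    refine dvd_sum_properGlue_sub haut hp hpm f (δ.pullback g) _ _ (fun η hη => ?_)
      (fun η hη => by rw [val_pullback_rot])
      fun η hη => hν.sum_selfGlue_comp f g δ η (Finset.mem_of_mem_erase hη)
    symm
    refine Finset.sum_bij (fun ε _ => ε.pullback (rot E H p)) (fun ε hε => ?_)
      (fun ε _ ε' _ h => FDiagram.pullback_injective (rot_surjective p) h) (fun ε hε => ?_)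
      (fun ε _ => (val_pullback_rot ν ε).symm)
    · rw [Finset.mem_filter] at hε ⊢
      refine ⟨pullback_rot_mem_selfGlue hε.1, ?_⟩
      rw [← hε.2, FDiagram.pullback_pullback, FDiagram.pullback_pullback, hurot]
    · rw [Finset.mem_filter] at hε
      refine ⟨ε.pullback (rotSymm E H p), ?_, pullback_rotSymm_rot ε⟩
      have hε1 := mem_selfGlue.1 hε.1
      rw [Finset.mem_filter, mem_selfGlue]
      refine ⟨⟨hε1.1, fun i => hε1.2.1 _, fun i d => hε1.2.2 _ d⟩,
        FDiagram.pullback_injective (rot_surjective p) ?_⟩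
      beta_reduce
      rw [FDiagram.pullback_pullback, hurot, ← FDiagram.pullback_pullback, ← hε.2,
        pullback_rotSymm_rot]
  -- gluings whose restriction along `g` is constant
  have hA : (p : R) ^ (n + 1) ∣
      ∑ ε ∈ properGlue p (g ∘ f) δ with ε.pullback u ∉ properGlue p f (δ.pullback g),
        ν.val (Sum.inl : E → E ⊕ Fin p × H) ε -
      ∑ κ ∈ properGlue p g δ,
        ν.val (Sum.inl : D → D ⊕ Fin p × H) κ * ν.val f (δ.pullback g) := by
    have heq : ∑ ε ∈ properGlue p (g ∘ f) δ with ε.pullback u ∉ properGlue p f (δ.pullback g),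
        ν.val (Sum.inl : E → E ⊕ Fin p × H) ε =
        ∑ κ ∈ properGlue p g δ, ν.val (Sum.inl ∘ f : E → D ⊕ Fin p × H) κ := by
      -- When the middle copies all coincide, the middle tuple can serve as the common base; `r`
      -- reads it off from the zeroth copy.
      let s : E ⊕ Fin p × H → D ⊕ Fin p × H := Sum.map f id
      let r : D ⊕ Fin p × H → E ⊕ Fin p × H := Sum.elim (fun d => Sum.inr (0, g d)) Sum.inr
      have hs {κ : FDiagram F (D ⊕ Fin p × H)} (hκ : κ ∈ selfGlue p g δ) :
          (κ.pullback s).pullback r = κ := by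
        rw [mem_selfGlue] at hκ
        refine κ.pullback_eq_self ?_
        rintro (x | x)
        · exact κ.eqv_symm (hκ.2.2 0 x)
        · exact κ.eqv_refl _
      have hr {ε : FDiagram F (E ⊕ Fin p × H)} (hε : ε ∈ selfGlue p (g ∘ f) δ) :
          (ε.pullback r).pullback s = ε := by
        rw [mem_selfGlue] at hε
        refine ε.pullback_eq_self ?_
        rintro (x | x)
        · exact ε.eqv_symm (hε.2.2 0 x)
        · exact ε.eqv_refl _
      have hsfold : (δ.pullback (fold p g)).pullback s = δ.pullback (fold p (g ∘ f)) :=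
        δ.pullback_congr (by rintro (x | x) <;> exact δ.eqv_refl _)
      have hrfold : (δ.pullback (fold p (g ∘ f))).pullback r = δ.pullback (fold p g) :=
        δ.pullback_congr (by rintro (x | x) <;> exact δ.eqv_refl _)
      refine Finset.sum_bij' (fun ε _ => ε.pullback r) (fun κ _ => κ.pullback s) ?_ ?_ ?_ ?_ ?_
      · intro ε hε
        rw [Finset.mem_filter] at hε
        have hε1 := Finset.mem_erase.1 hε.1
        have hfold : ε.pullback u = (δ.pullback g).pullback (fold p f) := by
          by_contra h
          exact hε.2 (Finset.mem_erase.2 ⟨h, hu hε1.2⟩)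
        rw [properGlue, Finset.mem_erase]
        refine ⟨fun h => hε1.1 ?_, ?_⟩
        · rw [← hr hε1.2, h, hsfold]
        · have hε2 := mem_selfGlue.1 hε1.2
          rw [mem_selfGlue]
          refine ⟨?_, hε2.2.1, fun i d => ?_⟩
          · change (ε.pullback fun x => Sum.inr (0, x)).pullback g = _
            rw [hε2.2.1]
          · have : (ε.pullback u).eqv (Sum.inr (0, d)) (Sum.inr (i, d)) := by
              rw [hfold]
              exact FDiagram.eqv_refl _ _
            exact this
      · intro κ hκ
        have hκ1 := Finset.mem_erase.1 hκ
        have hκ2 := mem_selfGlue.1 hκ1.2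
        rw [Finset.mem_filter, properGlue, Finset.mem_erase]
        refine ⟨⟨fun h => hκ1.1 ?_, ?_⟩, fun h => (Finset.mem_erase.1 h).1 ?_⟩
        · rw [← hs hκ1.2, h, hrfold]
        · rw [mem_selfGlue]
          refine ⟨?_, hκ2.2.1, fun i d => hκ2.2.2 i (f d)⟩
          change (κ.pullback Sum.inl).pullback f = _
          rw [hκ2.1]
          rfl
        · refine Eq.trans ?_ (congrArg (fun γ => FDiagram.pullback γ (fold p f)) hκ2.1)
          refine κ.pullback_congr ?_
          rintro (x | ⟨i, x⟩)
          · exact κ.eqv_refl _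
          · exact κ.eqv_symm (hκ2.2.2 i x)
      · exact fun ε hε => hr (Finset.mem_of_mem_erase (Finset.mem_filter.1 hε).1)
      · exact fun κ hκ => hs (Finset.mem_of_mem_erase hκ)
      · intro ε hε
        have hε1 := Finset.mem_of_mem_erase (Finset.mem_filter.1 hε).1
        have hε2 := mem_selfGlue.1 hε1
        refine (ν.val_congr Sum.inl (Sum.inl ∘ f) r ε ?_ (fun x => ⟨x, hε2.2.2 0 x⟩)
          (fun x => ⟨x, hε2.2.2 0 x⟩)).symm
        rintro (x | x)
        · exact ⟨Sum.inr (0, g (f x)), ε.eqv_symm (hε2.2.2 0 x)⟩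
        · exact ⟨Sum.inr x, ε.eqv_refl _⟩
    rw [heq]
    refine dvd_sum_properGlue_sub haut hp hpm g δ
      (fun κ => ν.val (Sum.inl ∘ f : E → D ⊕ Fin p × H) κ) _ (fun κ hκ => ?_)
      (fun κ hκ => by rw [val_pullback_rot]) fun κ hκ => ?_
    · exact ν.val_congr _ _ _ _ (fun y => (rot_surjective p y).imp fun _ h => κ.eqv_of_eq h)
        (fun x => ⟨x, κ.eqv_refl _⟩) (fun x => ⟨x, κ.eqv_refl _⟩)
    · have := hν.mul f (Sum.inl : D → D ⊕ Fin p × H) κ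
      rwa [(mem_selfGlue.1 (Finset.mem_of_mem_erase hκ)).1] at this
  have hpow := pow_succ_dvd_pow_sub_pow hn (hν.mul f g δ)
  have hsub := hν.frobLift_sub hp f (δ.pullback g)
  have hK := dvd_sum_properGlue haut hp hpm ν g δ
  have hsplit := Finset.sum_filter_add_sum_filter_not (properGlue p (g ∘ f) δ)
    (fun ε => ε.pullback u ∈ properGlue p f (δ.pullback g))
    (fun ε => ν.val (Sum.inl : E → E ⊕ Fin p × H) ε)
  rw [← Finset.sum_mul] at hA hB
  rw [frobLift_val] at hsub
  rw [frobLift_val, frobLift_val, frobLift_val, ← hsplit]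
  -- The error term: p divides N_g, and p^n divides the difference between the lift of ν(f) and
  -- ν(f).
  have hKN := mul_dvd_mul hK hsub
  rw [← pow_succ'] at hKN
  convert dvd_add (dvd_sub (dvd_sub hpow hA) hB) hKN using 1
  ring

-- Amalgamating a gluing `η` of p copies of α with β amounts to gluing, along β, p amalgamations of
-- α with β whose α-parts form `η`.
omit hpm haut in
open scoped Classical in
theorem Weight.IsMeasureMod.sum_amals_glue {q : R} (hν : ν.IsMeasureMod q) {A B C : Type w}
    [Finite A] [Finite B] [Finite C] (f : C → A) (g : C → B) (α : FDiagram F A)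
    (β : FDiagram F B) (h : α.pullback f = β.pullback g) (η : FDiagram F (C ⊕ Fin p × A))
    (hη : η ∈ selfGlue p f α) :
    q ∣ ν.val (Sum.inl : C → C ⊕ Fin p × A) η -
      ∑ κ : FDiagram F (B ⊕ Fin p × (A ⊕ B)) with
        (κ ∈ glue Sum.inr (fun _ => id) (fun i => κ.pullback fun x => Sum.inr (i, x)) β ∧
          ∀ i, (κ.pullback fun x => Sum.inr (i, x)) ∈ amals f g α β) ∧
        κ.pullback (Sum.map g (Prod.map id Sum.inl)) = η,
        ν.val (Sum.inl : B → B ⊕ Fin p × (A ⊕ B)) κ := by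
  have : NeZero p := ⟨hp.ne_zero⟩
  let s : (C ⊕ Fin p × A) ⊕ B → B ⊕ Fin p × (A ⊕ B) :=
    Sum.elim (Sum.map g (Prod.map id Sum.inl)) Sum.inl
  let t : B ⊕ Fin p × (A ⊕ B) → (C ⊕ Fin p × A) ⊕ B :=
    Sum.elim Sum.inr fun x => Sum.elim (fun a => Sum.inl (Sum.inr (x.1, a))) Sum.inr x.2
  rw [mem_selfGlue] at hη
  convert hν.amal (Sum.inl : C → C ⊕ Fin p × A) g η β (hη.1.trans h) using 2
  have ht {κ : FDiagram F (B ⊕ Fin p × (A ⊕ B))}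
      (hκ : κ ∈ glue Sum.inr (fun _ => id) (fun i => κ.pullback fun x => Sum.inr (i, x)) β) (x) :
      κ.eqv (s (t x)) x := by
    rw [mem_glue] at hκ
    rcases x with x | ⟨i, x | x⟩
    · exact κ.eqv_refl _
    · exact κ.eqv_refl _
    · exact hκ.2.2 i x
  refine Finset.sum_bij' (fun κ _ => κ.pullback s) (fun χ _ => χ.pullback t) ?_ ?_ ?_ ?_ ?_
  · intro κ hκ
    rw [Finset.mem_filter] at hκ
    obtain ⟨-, ⟨h1, h2⟩, h3⟩ := hκ
    rw [mem_amals]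
    exact ⟨h3, (mem_glue.1 h1).1, fun c => κ.eqv_refl _⟩
  · intro χ hχ
    rw [mem_amals] at hχ
    obtain ⟨h1, h2, h3⟩ := hχ
    rw [Finset.mem_filter]
    refine ⟨Finset.mem_univ _, ⟨?_, fun i => ?_⟩, ?_⟩
    · rw [mem_glue]
      exact ⟨h2, fun i => rfl, fun i b => χ.eqv_refl _⟩
    · rw [mem_amals]
      refine ⟨?_, h2, fun c => ?_⟩
      · change (χ.pullback Sum.inl).pullback (fun a => Sum.inr (i, a)) = _
        rw [h1, hη.2.1]
      · exact χ.eqv_trans (χ.eqv_symm (FDiagram.eqv_of_pullback h1 (hη.2.2 i c))) (h3 c)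
    · rw [← h1]
      refine χ.pullback_congr ?_
      rintro (x | x)
      · exact χ.eqv_symm (h3 x)
      · exact χ.eqv_refl _
  · intro κ hκ
    rw [Finset.mem_filter] at hκ
    exact κ.pullback_eq_self (ht hκ.2.1.1)
  · intro χ hχ
    rw [mem_amals] at hχ
    refine χ.pullback_eq_self ?_
    rintro ((x | x) | x)
    · exact χ.eqv_symm (hχ.2.2 x)
    · exact χ.eqv_refl _
    · exact χ.eqv_refl _
  · intro κ hκ
    rw [Finset.mem_filter] at hκ
    exact (ν.val_congr Sum.inl Sum.inr s κ (fun y => ⟨t y, ht hκ.2.1.1 y⟩) (fun x => ⟨x, κ.eqv_refl _⟩)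
      (fun x => ⟨x, κ.eqv_refl _⟩)).symm

/-- Expand the p-th power of the sum over amalgamations. Constant families give the p-th powers
required. Products over nonconstant families cancel, modulo p^(n+1), against the gluings over β
whose members `T κ` differ. What remains of the proper gluings of α consists of proper gluings of a
single amalgamation with itself, as the lift demands. -/
theorem Weight.IsMeasureMod.frobLift_amal (hn : n ≠ 0) (hν : ν.IsMeasureMod ((p : R) ^ n))
    {A B C : Type w} [Finite A] [Finite B] [Finite C] (f : C → A) (g : C → B)
    (α : FDiagram F A) (β : FDiagram F B) (h : α.pullback f = β.pullback g) :
    (p : R) ^ (n + 1) ∣ (ν.frobLift p).val f α -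
      ∑ ε ∈ amals f g α β, (ν.frobLift p).val (Sum.inr : B → A ⊕ B) ε := by
  classical
  have : NeZero p := ⟨hp.ne_zero⟩
  let T : FDiagram F (B ⊕ Fin p × (A ⊕ B)) → Fin p → FDiagram F (A ⊕ B) :=
    fun κ i => κ.pullback fun x => Sum.inr (i, x)
  let K : Finset (FDiagram F (B ⊕ Fin p × (A ⊕ B))) := Finset.univ.filter fun κ =>
    κ ∈ glue Sum.inr (fun _ => id) (T κ) β ∧ ∀ i, T κ i ∈ amals f g α β
  let w : C ⊕ Fin p × A → B ⊕ Fin p × (A ⊕ B) := Sum.map g (Prod.map id Sum.inl)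
  have hK {κ} (hκ : κ ∈ K) : κ ∈ glue Sum.inr (fun _ => id) (T κ) β ∧
      ∀ i, T κ i ∈ amals f g α β := (Finset.mem_filter.1 hκ).2
  have hKrot {κ} (hκ : κ ∈ K) : κ.pullback (rot B (A ⊕ B) p) ∈ K := by
    have h1 := hK hκ
    rw [mem_glue] at h1
    refine Finset.mem_filter.2 ⟨Finset.mem_univ _, ?_, fun i => h1.2 (finRotate p i)⟩
    rw [mem_glue]
    exact ⟨h1.1.1, fun i => rfl, fun i b => h1.1.2.2 _ b⟩
  have hwrot : rot B (A ⊕ B) p ∘ w = w ∘ rot C A p := by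
    funext x
    rcases x with x | x <;> rfl
  have hw {κ} (hκ : κ ∈ K) : κ.pullback w ∈ selfGlue p f α := by
    have h1 := hK hκ
    rw [mem_glue] at h1
    have h2 i := mem_amals.1 (h1.2 i)
    rw [mem_selfGlue]
    refine ⟨?_, fun i => (h2 i).1, fun i c => ?_⟩
    · change (κ.pullback Sum.inl).pullback g = _
      rw [h1.1.1, h]
    · exact κ.eqv_trans (h1.1.2.2 i (g c)) (κ.eqv_symm ((h2 i).2.2 c))
  -- the sum over proper gluings, in terms of gluings over `β`
  have hN : (p : R) ^ (n + 1) ∣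
      ∑ η ∈ properGlue p f α, ν.val (Sum.inl : C → C ⊕ Fin p × A) η -
      ∑ κ ∈ K with κ.pullback w ∈ properGlue p f α,
        ν.val (Sum.inl : B → B ⊕ Fin p × (A ⊕ B)) κ := by
    have heq : ∑ κ ∈ K with κ.pullback w ∈ properGlue p f α,
        ν.val (Sum.inl : B → B ⊕ Fin p × (A ⊕ B)) κ = ∑ η ∈ properGlue p f α,
        ∑ κ ∈ K with κ.pullback w = η, ν.val (Sum.inl : B → B ⊕ Fin p × (A ⊕ B)) κ := by
      rw [← Finset.sum_fiberwise_of_maps_to (fun ε hε => (Finset.mem_filter.1 hε).2)]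
      refine Finset.sum_congr rfl fun η hη => Finset.sum_congr ?_ fun _ _ => rfl
      ext κ
      simp only [Finset.mem_filter]
      constructor
      · rintro ⟨⟨h1, -⟩, h2⟩
        exact ⟨h1, h2⟩
      · rintro ⟨h1, rfl⟩
        exact ⟨⟨h1, hη⟩, rfl⟩
    rw [heq]
    refine dvd_sum_properGlue_sub haut hp hpm f α _ _
      (fun η hη => by rw [val_pullback_rot]) (fun η hη => ?_) fun η hη => ?_
    · symm
      refine Finset.sum_bij (fun κ _ => κ.pullback (rot B (A ⊕ B) p)) (fun κ hκ => ?_)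
        (fun κ _ κ' _ h => FDiagram.pullback_injective (rot_surjective p) h) (fun κ hκ => ?_)
        (fun κ _ => (val_pullback_rot ν κ).symm)
      · rw [Finset.mem_filter] at hκ ⊢
        refine ⟨hKrot hκ.1, ?_⟩
        rw [← hκ.2, FDiagram.pullback_pullback, hwrot, ← FDiagram.pullback_pullback]
      · rw [Finset.mem_filter] at hκ
        refine ⟨κ.pullback (rotSymm B (A ⊕ B) p), ?_, pullback_rotSymm_rot κ⟩
        have h1 := hK hκ.1
        rw [mem_glue] at h1
        refine Finset.mem_filter.2 ⟨Finset.mem_filter.2 ⟨Finset.mem_univ _, ?_,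
          fun i => h1.2 ((finRotate p).symm i)⟩, FDiagram.pullback_injective (rot_surjective p) ?_⟩
        · rw [mem_glue]
          exact ⟨h1.1.1, fun i => rfl, fun i b => h1.1.2.2 _ b⟩
        · beta_reduce
          rw [FDiagram.pullback_pullback, ← hwrot, ← FDiagram.pullback_pullback, ← hκ.2,
            pullback_rotSymm_rot]
    · have := hν.sum_amals_glue hp f g α β h η (Finset.mem_of_mem_erase hη)
      rw [Finset.filter_filter]
      exact this
  -- gluings over `β` with different members
  have hfib (t : Fin p → FDiagram F (A ⊕ B)) (ht : ∀ i, t i ∈ amals f g α β) :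
      {κ ∈ K | T κ = t} = glue Sum.inr (fun _ => id) t β := by
    ext κ
    rw [Finset.mem_filter]
    constructor
    · rintro ⟨h1, rfl⟩
      exact (hK h1).1
    · intro h1
      have h2 : T κ = t := funext (mem_glue.1 h1).2.1
      subst h2
      exact ⟨Finset.mem_filter.2 ⟨Finset.mem_univ _, h1, ht⟩, rfl⟩
  -- The copies of β coincide in any case, so coincidence of the copies of α makes whole
  -- amalgamations coincide. Hence differing members force a proper restriction to α.
  have hfold {κ} (hκ : κ ∈ K) (hκ' : κ.pullback w = α.pullback (fold p f)) (i j : Fin p) (x) :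
      κ.eqv (Sum.inr (i, x)) (Sum.inr (j, x)) := by
    have h1 := mem_glue.1 (hK hκ).1
    rcases x with x | x
    · have : (κ.pullback w).eqv (Sum.inr (i, x)) (Sum.inr (j, x)) := by
        rw [hκ']
        exact FDiagram.eqv_refl _ _
      exact this
    · exact κ.eqv_trans (κ.eqv_symm (h1.2.2 i x)) (h1.2.2 j x)
  let P : Finset (Fin p → FDiagram F (A ⊕ B)) := Fintype.piFinset fun _ => amals f g α β
  have hTP {κ} (hκ : κ ∈ K) : T κ ∈ P := Fintype.mem_piFinset.2 (hK hκ).2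
  let Q : (Fin p → FDiagram F (A ⊕ B)) → Prop := fun t => ∀ i j, t i = t j
  have hnonconst : (p : R) ^ (n + 1) ∣
      ∑ κ ∈ K with ¬ Q (T κ), ν.val (Sum.inl : B → B ⊕ Fin p × (A ⊕ B)) κ -
      ∑ t ∈ P with ¬ Q t, ∏ i, ν.val (Sum.inr : B → A ⊕ B) (t i) := by
    rw [← Finset.sum_fiberwise_of_maps_to (s := {κ ∈ K | ¬ Q (T κ)}) (t := {t ∈ P | ¬ Q t}) (g := T)
      fun κ hκ => by
        rw [Finset.mem_filter] at hκ ⊢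
        exact ⟨hTP hκ.1, hκ.2⟩]
    have heq : ∀ t ∈ {t ∈ P | ¬ Q t}, ∑ κ ∈ {κ ∈ K | ¬ Q (T κ)} with T κ = t,
        ν.val (Sum.inl : B → B ⊕ Fin p × (A ⊕ B)) κ =
        ∑ κ ∈ glue Sum.inr (fun _ => id) t β, ν.val (Sum.inl : B → B ⊕ Fin p × (A ⊕ B)) κ := by
      intro t ht
      rw [Finset.mem_filter] at ht
      rw [← hfib t (Fintype.mem_piFinset.1 ht.1)]
      refine Finset.sum_congr ?_ fun _ _ => rfl
      ext κ
      simp only [Finset.mem_filter]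
      constructor
      · rintro ⟨⟨h1, -⟩, h2⟩
        exact ⟨h1, h2⟩
      · rintro ⟨h1, rfl⟩
        exact ⟨⟨h1, ht.2⟩, rfl⟩
    rw [Finset.sum_congr rfl heq, ← Finset.sum_sub_distrib]
    -- Here the rotation acts on families of amalgamations; its fixed points are the constant
    -- families, so nonconstant ones again gain a factor p.
    have hσ : (fun t : Fin p → FDiagram F (A ⊕ B) => t ∘ finRotate p)^[p] = id := by
      have hk (k : ℕ) (t : Fin p → FDiagram F (A ⊕ B)) :
          (fun t : Fin p → FDiagram F (A ⊕ B) => t ∘ finRotate p)^[k] t =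
            t ∘ (finRotate p)^[k] := by
        induction k with
        | zero => rfl
        | succ k ih => rw [Function.iterate_succ_apply', ih, Function.iterate_succ]; rfl
      funext t
      rw [hk, finRotate_iterate_self]
      rfl
    obtain ⟨s, hs, hs'⟩ := exists_sum_eq_smul_of_iterate_eq_id hp hσ
      (fun t => ∑ κ ∈ glue Sum.inr (fun _ => id) t β,
          ν.val (Sum.inl : B → B ⊕ Fin p × (A ⊕ B)) κ -
        ∏ i, ν.val (Sum.inr : B → A ⊕ B) (t i))
      (Ideal.span {(p : R) ^ n}).toAddSubmonoid {t ∈ P | ¬ Q t}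
      (fun t ht => by
        rw [Finset.mem_filter, Fintype.mem_piFinset] at ht ⊢
        refine ⟨fun i => ht.1 _, fun hQ => ht.2 fun i j => ?_⟩
        have := hQ ((finRotate p).symm i) ((finRotate p).symm j)
        simpa only [Function.comp_apply, Equiv.apply_symm_apply] using this)
      (fun t ht h => (Finset.mem_filter.1 ht).2 fun i j =>
        rel_of_finRotate (Setoid.ker t) (fun i => congrFun h i) i j)
      (fun t ht => by
        rw [Finset.mem_filter, Fintype.mem_piFinset] at ht
        congr 1
        · symm
          refine Finset.sum_bij (fun κ _ => κ.pullback (rot B (A ⊕ B) p)) (fun κ hκ => ?_)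
            (fun κ _ κ' _ h => FDiagram.pullback_injective (rot_surjective p) h) (fun κ hκ => ?_)
            (fun κ _ => (val_pullback_rot ν κ).symm)
          · rw [mem_glue] at hκ ⊢
            exact ⟨hκ.1, fun i => hκ.2.1 _, fun i b => hκ.2.2 _ b⟩
          · rw [mem_glue] at hκ
            refine ⟨κ.pullback (rotSymm B (A ⊕ B) p), ?_, pullback_rotSymm_rot κ⟩
            rw [mem_glue]
            refine ⟨hκ.1, fun i => ?_, fun i b => hκ.2.2 _ b⟩
            refine (hκ.2.1 _).trans ?_
            simp only [Function.comp_apply, Equiv.apply_symm_apply]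
        · exact Equiv.prod_comp (finRotate p) fun i => ν.val (Sum.inr : B → A ⊕ B) (t i))
      (fun t ht => by
        rw [Finset.mem_filter, Fintype.mem_piFinset] at ht
        exact Ideal.mem_span_singleton.2 (hν.sum_glue _ _ _ _ fun i => (mem_amals.1 (ht.1 i)).2.1))
    rw [hs', nsmul_eq_mul, pow_succ']
    exact mul_dvd_mul_left _ (Ideal.mem_span_singleton.1 hs)
  -- gluings over `β` with equal members
  have hconst : ∑ κ ∈ {κ ∈ K | κ.pullback w ∈ properGlue p f α} with Q (T κ),
        ν.val (Sum.inl : B → B ⊕ Fin p × (A ⊕ B)) κ =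
      ∑ ε ∈ amals f g α β, ∑ κ ∈ properGlue p Sum.inr ε,
        ν.val (Sum.inl : B → B ⊕ Fin p × (A ⊕ B)) κ := by
    rw [← Finset.sum_fiberwise_of_maps_to (t := amals f g α β) (g := fun κ => T κ 0)
      fun κ hκ => (hK (Finset.mem_filter.1 (Finset.mem_filter.1 hκ).1).1).2 0]
    refine Finset.sum_congr rfl fun ε hε => Finset.sum_congr ?_ fun _ _ => rfl
    have hεβ := (mem_amals.1 hε).2.1
    have hself : selfGlue p Sum.inr ε = glue Sum.inr (fun _ => id) (fun _ => ε) β := by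
      rw [selfGlue, hεβ]
    ext κ
    have hmem : κ ∈ properGlue p Sum.inr ε ↔ κ ≠ ε.pullback (fold p Sum.inr) ∧ κ ∈ K ∧
        T κ = fun _ => ε := by
      rw [properGlue, Finset.mem_erase, hself, ← hfib _ fun _ => hε, Finset.mem_filter]
    rw [hmem]
    simp only [Finset.mem_filter]
    constructor
    · rintro ⟨⟨⟨h1, h2⟩, h3⟩, rfl⟩
      refine ⟨?_, h1, funext fun i => h3 i 0⟩
      intro h4
      refine (Finset.mem_erase.1 h2).1 ?_
      refine eq_fold_of_eqv (hw h1) fun i j x => ?_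
      have : κ.eqv (Sum.inr (i, Sum.inl x)) (Sum.inr (j, Sum.inl x)) := by
        rw [h4]
        exact FDiagram.eqv_refl _ _
      exact this
    · rintro ⟨h1, h2, h3⟩
      refine ⟨⟨⟨h2, Finset.mem_erase.2 ⟨fun h4 => h1 ?_, hw h2⟩⟩, fun i j => ?_⟩, ?_⟩
      · refine eq_fold_of_eqv ?_ (hfold h2 h4)
        rw [hself, ← hfib _ fun _ => hε, Finset.mem_filter]
        exact ⟨h2, h3⟩
      · rw [h3]
      · rw [h3]
  have hsplit : ∑ κ ∈ K with κ.pullback w ∈ properGlue p f α,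
      ν.val (Sum.inl : B → B ⊕ Fin p × (A ⊕ B)) κ =
      ∑ ε ∈ amals f g α β, ∑ κ ∈ properGlue p Sum.inr ε,
        ν.val (Sum.inl : B → B ⊕ Fin p × (A ⊕ B)) κ +
      ∑ κ ∈ K with ¬ Q (T κ), ν.val (Sum.inl : B → B ⊕ Fin p × (A ⊕ B)) κ := by
    rw [← Finset.sum_filter_add_sum_filter_not {κ ∈ K | κ.pullback w ∈ properGlue p f α}
      (fun κ => Q (T κ)), hconst]
    congr 1
    refine Finset.sum_congr ?_ fun _ _ => rfl
    ext κ
    simp only [Finset.mem_filter]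
    constructor
    · rintro ⟨⟨h1, -⟩, h2⟩
      exact ⟨h1, h2⟩
    · rintro ⟨h1, h2⟩
      refine ⟨⟨h1, Finset.mem_erase.2 ⟨fun h3 => h2 fun i j => ?_, hw h1⟩⟩, h2⟩
      exact κ.pullback_congr fun x => hfold h1 h3 i j x
  have hprod : (∑ ε ∈ amals f g α β, ν.val (Sum.inr : B → A ⊕ B) ε) ^ p =
      ∑ ε ∈ amals f g α β, ν.val (Sum.inr : B → A ⊕ B) ε ^ p +
      ∑ t ∈ P with ¬ Q t, ∏ i, ν.val (Sum.inr : B → A ⊕ B) (t i) := by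
    have h1 := Finset.prod_univ_sum (fun _ : Fin p => amals f g α β)
      (fun _ => ν.val (Sum.inr : B → A ⊕ B))
    rw [Finset.prod_const, Finset.card_univ, Fintype.card_fin] at h1
    rw [h1, ← Finset.sum_filter_add_sum_filter_not _ Q]
    congr 1
    refine Finset.sum_bij' (fun t _ => t 0) (fun ε _ => fun _ => ε) ?_ ?_ ?_ ?_ ?_
    · intro t ht
      exact Fintype.mem_piFinset.1 (Finset.mem_filter.1 ht).1 0
    · intro ε hε
      exact Finset.mem_filter.2 ⟨Fintype.mem_piFinset.2 fun _ => hε, fun _ _ => rfl⟩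
    · intro t ht
      exact funext fun i => (Finset.mem_filter.1 ht).2 0 i
    · intro ε hε
      rfl
    · intro t ht
      rw [Finset.prod_congr rfl fun i _ =>
        congrArg (ν.val (Sum.inr : B → A ⊕ B)) ((Finset.mem_filter.1 ht).2 i 0)]
      simp
  have hpow := pow_succ_dvd_pow_sub_pow hn (hν.amal f g α β h)
  rw [hprod] at hpow
  rw [hsplit] at hN
  simp only [frobLift_val, Finset.sum_sub_distrib]
  convert dvd_sub (dvd_sub hpow hN) hnonconst using 1
  ring

theorem Weight.IsMeasureMod.frobLift (hn : n ≠ 0) (hν : ν.IsMeasureMod ((p : R) ^ n)) :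
    (ν.frobLift p).IsMeasureMod ((p : R) ^ (n + 1)) :=
  isMeasureMod_of_dvd (fun f δ h => hν.frobLift_one hn hp f δ h)
    (fun f g δ => hν.frobLift_mul haut hp hpm hn f g δ)
    (fun f g α β h => hν.frobLift_amal haut hp hpm hn f g α β h)

end FrobeniusLift

end FraisseMeasure

namespace FraisseMeasure

open FirstOrder.Language FirstOrder.Language.Structure

variable {L : FirstOrder.Language.{u, v}} [L.IsRelational]
  {F : Set (CategoryTheory.Bundled.{w} L.Structure)} [hF : Fact (IsFraisseClass F)]

/-! ### Passage to the p-adic limit -/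

section Limit

variable {R : Type z} [CommRing R] {p : ℕ}

theorem smodEq_span_pow_iff {q a b : R} {n : ℕ} :
    a ≡ b [SMOD (Ideal.span {q} ^ n • ⊤ : Submodule R R)] ↔ q ^ n ∣ a - b := by
  rw [SModEq.sub_mem, smul_eq_mul, Ideal.mul_top, Ideal.span_singleton_pow,
    Ideal.mem_span_singleton]

theorem Weight.iterate_frobLift {m : ℕ} (haut : AutBounded F m) (hp : p.Prime) (hpm : ¬ p ∣ m)
    {ν : Weight F R} (hν : ν.IsMeasureMod (p : R)) (n : ℕ) :
    ((Weight.frobLift p)^[n] ν).IsMeasureMod ((p : R) ^ (n + 1)) := by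
  induction n with
  | zero => simpa using hν
  | succ n ih =>
    rw [Function.iterate_succ_apply']
    exact ih.frobLift haut hp hpm n.succ_ne_zero

/-- Modular measures lift to complete rings. -/
theorem Weight.exists_isMeasure_lift [IsAdicComplete (Ideal.span {(p : R)}) R] {m : ℕ}
    (haut : AutBounded F m) (hp : p.Prime) (hpm : ¬ p ∣ m)
    {ν : Weight F R} (hν : ν.IsMeasureMod (p : R)) :
    ∃ ν' : Weight F R, ν'.IsMeasure ∧ ∀ {E D : Type w} [Finite E] [Finite D] (f : E → D)
      (δ : FDiagram F D), (p : R) ∣ ν'.val f δ - ν.val f δ := by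
  classical
  let s : ℕ → Weight F R := fun n => (Weight.frobLift p)^[n] ν
  have hs (n : ℕ) : (s n).IsMeasureMod ((p : R) ^ (n + 1)) := Weight.iterate_frobLift haut hp hpm hν n
  have hsucc {E D : Type w} [Finite E] [Finite D] (f : E → D) (δ : FDiagram F D) (n : ℕ) :
      (p : R) ^ (n + 1) ∣ (s (n + 1)).val f δ - (s n).val f δ := by
    have := (hs n).frobLift_sub hp f δ
    simpa only [s, Function.iterate_succ_apply'] using this
  have hle {E D : Type w} [Finite E] [Finite D] (f : E → D) (δ : FDiagram F D) {a b : ℕ}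
      (hab : a ≤ b) : (p : R) ^ (a + 1) ∣ (s b).val f δ - (s a).val f δ := by
    induction b, hab using Nat.le_induction with
    | base => simp
    | succ b hb ih =>
      have := dvd_add ((pow_dvd_pow (p : R) (Nat.succ_le_succ hb)).trans (hsucc f δ b)) ih
      convert this using 1
      ring
  -- The convergence hypothesis stands inside the existential so that the chosen limit depends on
  -- the sequence alone; invariance of the limit weight is then immediate. Other sequences get the
  -- value 0.
  have hlim (t : ℕ → R) : ∃ x : R, (∀ a b : ℕ, a ≤ b → (p : R) ^ (a + 1) ∣ t b - t a) →
      ∀ n, (p : R) ^ (n + 1) ∣ x - t n := by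
    by_cases ht : ∀ a b : ℕ, a ≤ b → (p : R) ^ (a + 1) ∣ t b - t a
    · obtain ⟨x, hx⟩ := IsPrecomplete.prec (I := Ideal.span {(p : R)}) inferInstance (f := t)
        fun {a b} hab => smodEq_span_pow_iff.2
          ((pow_dvd_pow _ a.le_succ).trans ((dvd_sub_comm).1 (ht a b hab)))
      refine ⟨x, fun _ n => ?_⟩
      have h1 := smodEq_span_pow_iff.1 (hx (n + 1))
      have := dvd_sub (ht n (n + 1) n.le_succ) h1
      convert this using 1
      ring
    · exact ⟨0, fun h => absurd h ht⟩
  choose lim hlim using hlim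
  have hzero {x : R} (h : ∀ n : ℕ, (p : R) ^ (n + 1) ∣ x) : x = 0 :=
    IsHausdorff.haus (I := Ideal.span {(p : R)}) inferInstance x fun n =>
      smodEq_span_pow_iff.2 (by rw [sub_zero]; exact (pow_dvd_pow _ n.le_succ).trans (h n))
  let ν' : Weight F R :=
    { val := fun f δ => lim fun n => (s n).val f δ
      val_congr := fun f f' e δ h1 h2 h3 =>
        congrArg lim (funext fun n => (s n).val_congr f f' e δ h1 h2 h3) }
  have hν' {E D : Type w} [Finite E] [Finite D] (f : E → D) (δ : FDiagram F D) (n : ℕ) :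
      (p : R) ^ (n + 1) ∣ ν'.val f δ - (s n).val f δ :=
    hlim (fun n => (s n).val f δ) (fun a b hab => hle f δ hab) n
  refine ⟨ν', ⟨fun f δ h => ?_, fun f g δ => ?_, fun f g α β h => ?_⟩, fun f δ => ?_⟩
  · refine sub_eq_zero.1 (hzero fun n => ?_)
    have := dvd_add (hν' f δ n) ((hs n).one f δ h)
    convert this using 1
    ring
  · refine sub_eq_zero.1 (hzero fun n => ?_)
    have := dvd_sub (dvd_sub (dvd_add (hν' (g ∘ f) δ n) ((hs n).mul f g δ))
      ((hν' g δ n).mul_right (ν'.val f (δ.pullback g))))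
      ((hν' f (δ.pullback g) n).mul_left ((s n).val g δ))
    convert this using 1
    ring
  · refine sub_eq_zero.1 (hzero fun n => ?_)
    have := dvd_sub (dvd_add (hν' f α n) ((hs n).amal f g α β h))
      (Finset.dvd_sum fun ε (_ : ε ∈ amals f g α β) => hν' Sum.inr ε n)
    convert this using 1
    rw [Finset.sum_sub_distrib]
    ring
  · simpa [s] using hν' f δ 0

end Limit

section Map

variable {R S : Type*} [CommRing R] [CommRing S]

/-- Composition of a measure with a ring homomorphism. -/
def Measure.map (μ : Measure F R) (φ : R →+* S) : Measure F S where
  val {X Y} i := φ (μ.val (X := X) (Y := Y) i)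
  val_iso {X Y} e := by rw [μ.val_iso, map_one]
  val_comp {X Y Z} i j := by rw [μ.val_comp, map_mul]
  val_amalgamation {X Y X'} i j n A hA := by rw [μ.val_amalgamation i j n A hA, map_sum]

/-- A measure with values in the image of an injective ring homomorphism comes from the source. -/
theorem Measure.exists_of_injective (μ : Measure F S) (φ : R →+* S)
    (hφ : Function.Injective φ)
    (h : ∀ (X Y : F) (i : X.1 ↪[L] Y.1), ∃ r, φ r = μ.val (X := X) (Y := Y) i) :
    ∃ μ' : Measure F R, ∀ (X Y : F) (i : X.1 ↪[L] Y.1),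
      φ (μ'.val (X := X) (Y := Y) i) = μ.val (X := X) (Y := Y) i := by
  choose r hr using h
  exact ⟨{
    val := fun {X Y} i => r X Y i
    val_iso := fun {X Y} e => hφ (by rw [hr, map_one]; exact μ.val_iso e)
    val_comp := fun {X Y Z} i j => hφ (by rw [map_mul, hr, hr, hr]; exact μ.val_comp i j)
    val_amalgamation := fun {X Y X'} i j n A hA => hφ (by
      rw [map_sum, hr, μ.val_amalgamation i j n A hA]
      exact Finset.sum_congr rfl fun α _ => (hr _ _ _).symm) }, hr⟩

end Map

/-- A regular measure with values in the field with `p` elements lifts to the `p`-adic numbers. -/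
theorem Measure.exists_isRegular_padic {m : ℕ} (haut : AutBounded F m) {p : ℕ}
    [hp : Fact p.Prime] (hpm : ¬ p ∣ m) (μ : Measure F (ZMod p)) (hμ : μ.IsRegular) :
    ∃ μ' : Measure F ℚ_[p], μ'.IsRegular := by
  -- Any set-theoretic section of the reduction serves: the axioms are needed only modulo p.
  let s : ZMod p → ℤ_[p] := fun x => (x.val : ℤ_[p])
  have hs (x : ZMod p) : PadicInt.toZMod (s x) = x := by simp [s]
  have hdvd {x : ℤ_[p]} : (p : ℤ_[p]) ∣ x ↔ PadicInt.toZMod x = 0 := by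
    rw [← RingHom.mem_ker, PadicInt.ker_toZMod, PadicInt.maximalIdeal_eq_span_p,
      Ideal.mem_span_singleton]
  have : IsAdicComplete (Ideal.span {(p : ℤ_[p])}) ℤ_[p] := by
    rw [← PadicInt.maximalIdeal_eq_span_p]; infer_instance
  let ν : Weight F ℤ_[p] :=
    { val := fun f δ => s (μ.toWeight.val f δ)
      val_congr := fun f f' e δ h1 h2 h3 => congrArg s (μ.toWeight.val_congr f f' e δ h1 h2 h3) }
  have hm := μ.toWeight_isMeasure
  have hν : ν.IsMeasureMod (p : ℤ_[p]) := by
    refine Weight.isMeasureMod_of_dvd (fun f δ h => ?_) (fun f g δ => ?_) (fun f g α β h => ?_)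
    · rw [hdvd, map_sub, map_one, hs, hm.one f δ h, sub_self]
    · rw [hdvd, map_sub, map_mul, hs, hs, hs, hm.mul f g δ, sub_self]
    · rw [hdvd, map_sub, map_sum, hs, hm.amal f g α β h]
      simp only [ν, hs, sub_self]
  obtain ⟨ν', hν', hcongr⟩ := Weight.exists_isMeasure_lift haut hp.out hpm hν
  refine ⟨hν'.toMeasure.map PadicInt.Coe.ringHom, fun {X Y} i => ?_⟩
  rw [isUnit_iff_ne_zero]
  intro h0
  have h1 : ν'.val i (FDiagram.ofMap Y id) = 0 := Subtype.coe_injective h0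
  have h2 := hcongr i (FDiagram.ofMap Y id)
  rw [h1, hdvd, map_sub, map_zero, hs, zero_sub, neg_eq_zero, μ.toWeight_embedding] at h2
  exact (hμ i).ne_zero h2

end FraisseMeasure

/-! ### Reduction to finitely many one-point extensions -/

namespace FraisseMeasure

open FirstOrder.Language FirstOrder.Language.Structure

variable {L : FirstOrder.Language.{u, v}} [L.IsRelational]
  {F : Set (CategoryTheory.Bundled.{w} L.Structure)} [hF : Fact (IsFraisseClass F)]
  {R : Type z} [CommRing R]

/-- A substructure of a member of the class, as a member of the class. -/
def subObject (X : F) (s : Set X.1) : F :=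
  ⟨⟨induced (L := L) s, inferInstance⟩,
    hF.out.hereditary X.1 X.2 _ ⟨(induced (L := L) s).subtype⟩⟩

/-- The inclusion of a substructure. -/
def subObjectIncl (X : F) (s : Set X.1) : (subObject X s).1 ↪[L] X.1 :=
  (induced (L := L) s).subtype

theorem range_subObjectIncl (X : F) (s : Set X.1) : Set.range (subObjectIncl X s) = s :=
  Subtype.range_coe

/-- Inclusions between substructures. -/
def subObjectMap (X : F) {s t : Set X.1} (h : s ⊆ t) : (subObject X s).1 ↪[L] (subObject X t).1 :=
  FirstOrder.Language.Substructure.inclusion (induced_mono (L := L) h)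

theorem Measure.val_eq_of_range_eq (μ : Measure F R) {X X' Y : F} (i : X.1 ↪[L] Y.1)
    (i' : X'.1 ↪[L] Y.1) (h : Set.range i = Set.range i') :
    μ.val (X := X) (Y := Y) i = μ.val (X := X') (Y := Y) i' := by
  rw [← μ.toWeight_embedding i, ← μ.toWeight_embedding i']
  refine (μ.toWeight.val_congr i' i id (FDiagram.ofMap Y id) (fun y => ⟨y, rfl⟩)
    (fun x => ?_) fun x => ?_)
  · obtain ⟨y, hy⟩ : i x ∈ Set.range i' := h ▸ ⟨x, rfl⟩
    exact ⟨y, hy⟩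
  · obtain ⟨y, hy⟩ : i' x ∈ Set.range i := h ▸ ⟨x, rfl⟩
    exact ⟨y, hy.symm⟩

/-- The value of a measure on the one-point extension that a marked structure defines. -/
def Measure.markedVal (μ : Measure F R) (M : MarkedStructure F) : R :=
  μ.val (X := subObject M.str {M.point}ᶜ) (Y := M.str) (subObjectIncl M.str {M.point}ᶜ)

theorem Measure.markedVal_eq_of_iso (μ : Measure F R) {M N : MarkedStructure F} (h : M.Iso N) :
    μ.markedVal M = μ.markedVal N := by
  obtain ⟨e, he⟩ := h
  have h1 : μ.markedVal M = μ.val (X := subObject M.str {M.point}ᶜ) (Y := N.str)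
      (e.toEmbedding.comp (subObjectIncl M.str {M.point}ᶜ)) := by
    rw [μ.val_comp, μ.val_iso, one_mul]
    rfl
  rw [h1]
  refine μ.val_eq_of_range_eq _ _ ?_
  rw [range_subObjectIncl]
  ext y
  constructor
  · rintro ⟨x, rfl⟩ h
    refine x.2 (e.injective ?_)
    rw [he]
    exact h
  · intro hy
    refine ⟨⟨e.symm y, fun h => hy ?_⟩, e.apply_symm_apply y⟩
    have : e.symm y = M.point := h
    rw [Set.mem_singleton_iff, ← he, ← this, e.apply_symm_apply]

/-- Removal of an unmarked point. -/
def MarkedStructure.remove (M : MarkedStructure F) (y : M.str.1) (hy : y ≠ M.point) :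
    MarkedStructure F where
  str := subObject M.str {y}ᶜ
  point := ⟨M.point, fun h => hy h.symm⟩

/-- Separation leaves a single amalgamation, so the sum in the amalgamation axiom has one term. -/
theorem Measure.markedVal_remove (μ : Measure F R) (M : MarkedStructure F) (y : M.str.1)
    (hy : M.Extraneous y) : μ.markedVal (M.remove y hy.1) = μ.markedVal M := by
  obtain ⟨X, x⟩ := M
  obtain ⟨hne, hsep⟩ := hy
  change X.1 at y
  change y ≠ x at hne
  change Separated F {y} {x} at hsep
  have h1 : ({y} ∪ {x} : Set X.1)ᶜ ⊆ {y}ᶜ := Set.compl_subset_compl.2 Set.subset_union_left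
  have h2 : ({y} ∪ {x} : Set X.1)ᶜ ⊆ {x}ᶜ := Set.compl_subset_compl.2 Set.subset_union_right
  let P : Amalgamation F (subObjectMap X h1) (subObjectMap X h2) :=
    { pt := X
      inl := subObjectIncl X {y}ᶜ
      inr := subObjectIncl X {x}ᶜ
      comm := rfl
      cover := by
        rw [range_subObjectIncl, range_subObjectIncl, ← Set.compl_inter,
          Set.compl_univ_iff.2]
        exact Set.singleton_inter_eq_empty.2 hne }
  have h3 := μ.val_amalgamation (X := subObject X ({y} ∪ {x})ᶜ) (Y := subObject X {y}ᶜ)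
    (X' := subObject X {x}ᶜ) (subObjectMap X h1) (subObjectMap X h2) 1 (fun _ => P) (fun Q => by
      refine ⟨0, ?_, fun _ _ => Subsingleton.elim _ _⟩
      obtain ⟨e, he1, he2⟩ := hsep Q
      exact Amalgamation.iso_equivalence.symm ⟨e, he1, he2⟩)
  rw [Fin.sum_univ_one] at h3
  refine Eq.trans ?_ h3
  refine μ.val_eq_of_range_eq (Y := subObject X {y}ᶜ) _ _ ?_
  refine (range_subObjectIncl _ _).trans ?_
  ext z
  constructor
  · intro hz
    refine ⟨⟨z.1, ?_⟩, rfl⟩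
    rintro (h | h)
    · exact z.2 h
    · exact hz (Subtype.ext h)
  · rintro ⟨z, rfl⟩ h
    exact z.2 (Or.inr (congrArg Subtype.val h))

theorem card_subObject_compl (X : F) (x : X.1) :
    Nat.card (subObject X {x}ᶜ).1 + 1 = Nat.card X.1 := by
  have := Set.ncard_add_ncard_compl ({x} : Set X.1)
  rw [Set.ncard_singleton, add_comm] at this
  exact this

theorem MarkedStructure.exists_isMinimal (M : MarkedStructure F) :
    ∃ N : MarkedStructure F, N.IsMinimal ∧ ∀ μ : Measure F R, μ.markedVal M = μ.markedVal N := by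
  induction hn : Nat.card M.str.1 using Nat.strong_induction_on generalizing M with
  | _ n ih =>
    by_cases hM : M.IsMinimal
    · exact ⟨M, hM, fun _ => rfl⟩
    · simp only [MarkedStructure.IsMinimal, not_forall, not_not] at hM
      obtain ⟨y, hy⟩ := hM
      have := card_subObject_compl M.str y
      obtain ⟨N, hN, h⟩ := ih _ (by rw [← hn, ← this]; exact Nat.lt_succ_self _)
        (M.remove y hy.1) rfl
      exact ⟨N, hN, fun μ => (μ.markedVal_remove M y hy).symm.trans (h μ)⟩

/-- Points are added one at a time, each giving one factor. The length is recorded because it later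
bounds the degree in the values on one-point extensions. -/
theorem exists_list_markedVal {X Y : F} (i : X.1 ↪[L] Y.1) :
    ∃ l : List (MarkedStructure F), l.length + Nat.card X.1 = Nat.card Y.1 ∧
      ∀ μ : Measure F R, μ.val (X := X) (Y := Y) i = (l.map μ.markedVal).prod := by
  induction hn : Nat.card Y.1 using Nat.strong_induction_on generalizing Y with
  | _ n ih =>
    by_cases hi : Function.Surjective i
    · refine ⟨[], ?_, fun μ => ?_⟩
      · rw [← hn, List.length_nil, zero_add]
        exact Nat.card_congr (Equiv.ofBijective i ⟨i.injective, hi⟩)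
      · rw [← μ.toWeight_embedding i, List.map_nil, List.prod_nil]
        exact μ.toWeight_isMeasure.one _ _ hi
    · simp only [Function.Surjective, not_forall, not_exists] at hi
      obtain ⟨y, hy⟩ := hi
      have hcard := card_subObject_compl Y y
      let i' : X.1 ↪[L] (subObject Y {y}ᶜ).1 := Embedding.codRestrict (induced (L := L) {y}ᶜ) i hy
      obtain ⟨l, hl, h⟩ := ih _ (by rw [← hn, ← hcard]; exact Nat.lt_succ_self _) i' rfl
      refine ⟨⟨Y, y⟩ :: l, ?_, fun μ => ?_⟩
      · rw [← hn, ← hcard, ← hl, List.length_cons]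
        ring
      · rw [List.map_cons, List.prod_cons, ← h μ]
        exact μ.val_comp i' (subObjectIncl Y {y}ᶜ)

/-- If there are finitely many minimal marked structures then the values of all measures are
products of the values on finitely many one-point extensions. -/
theorem exists_finite_markedVal (hfin : FinitelyManyMinimal F) (R : Type z) [CommRing R] :
    ∃ S : Set (MarkedStructure F), S.Finite ∧ ∀ (X Y : F) (i : X.1 ↪[L] Y.1),
      ∃ l : List (MarkedStructure F), (∀ M ∈ l, M ∈ S) ∧
        l.length + Nat.card X.1 = Nat.card Y.1 ∧
        ∀ μ : Measure F R, μ.val (X := X) (Y := Y) i = (l.map μ.markedVal).prod := by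
  obtain ⟨S, hS, h⟩ := hfin
  refine ⟨S, hS, fun X Y i => ?_⟩
  have hrep (M : MarkedStructure F) :
      ∃ N ∈ S, ∀ μ : Measure F R, μ.markedVal M = μ.markedVal N := by
    obtain ⟨N, hN, hMN⟩ := M.exists_isMinimal (R := R)
    obtain ⟨N', hN', hiso⟩ := h N hN
    exact ⟨N', hN', fun μ => (hMN μ).trans (μ.markedVal_eq_of_iso hiso)⟩
  choose rep hrepS hrep using hrep
  obtain ⟨l, hl, hl'⟩ := exists_list_markedVal (R := R) i
  refine ⟨l.map rep, fun M hM => ?_, by rwa [List.length_map], fun μ => ?_⟩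
  · obtain ⟨N, -, rfl⟩ := List.mem_map.1 hM
    exact hrepS N
  · rw [hl' μ, List.map_map]
    congr 1
    exact List.map_congr_left fun M _ => hrep M μ

/-- The embedding is chosen before the measure, so that two measures can be compared on the same
embedding. -/
theorem Measure.exists_val_eq {X : F} {D : Type w} [Finite D] (f : X.1 → D)
    (ε : FDiagram F D) (h : ε.pullback f = FDiagram.ofMap X id) :
    ∃ k : X.1 ↪[L] ε.str.1, ∀ μ : Measure F R,
      μ.toWeight.val f ε = μ.val (X := X) (Y := ε.str) k := by
  have h1 : Diagram.ofMap (L := L) (id : X.1 → X.1) = Diagram.ofMap (ε.mk ∘ f) := by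
    rw [← Diagram.ofMap_pullback, ε.ofMap_mk_val]
    exact (congrArg Subtype.val h).symm
  refine ⟨Diagram.embOfMap id _ Function.surjective_id h1, fun μ => ?_⟩
  conv_lhs => rw [← ε.ofMap_mk]
  exact μ.toWeight_eq f _ id ε.mk Function.surjective_id ε.mk_surjective
    fun x => (Diagram.embOfMap_apply _ _ Function.surjective_id h1 x).symm

theorem ofMap_pullback_embedding {X Y : F} (i : X.1 ↪[L] Y.1) :
    (FDiagram.ofMap Y id).pullback i = FDiagram.ofMap X id :=
  Subtype.ext (Diagram.ofMap_comp_embedding _ _)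

end FraisseMeasure

namespace FraisseMeasure

open FirstOrder.Language FirstOrder.Language.Structure

variable {L : FirstOrder.Language.{u, v}} [L.IsRelational]
  {F : Set (CategoryTheory.Bundled.{w} L.Structure)} [hF : Fact (IsFraisseClass F)]

/-! ### The identity relating a value to its p-th power -/

section PrimePower

variable {R : Type z} [CommRing R] {m p : ℕ} (haut : AutBounded F m) (hp : p.Prime)
  (hpm : ¬ p ∣ m)
include haut hp hpm

/-- The difference is the sum over proper gluings, which fall into rotation orbits of size p. The
submonoid `N` carries bounds on single terms over to the quotient. -/
theorem Measure.exists_pow_sub_self (μ : Measure F R) {X Y : F} (i : X.1 ↪[L] Y.1)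
    (N : AddSubmonoid R)
    (hN : ∀ ε ∈ properGlue p i (FDiagram.ofMap Y id), μ.toWeight.val Sum.inl ε ∈ N) :
    ∃ s ∈ N, μ.val (X := X) (Y := Y) i ^ p - μ.val (X := X) (Y := Y) i = p * s := by
  have : NeZero p := ⟨hp.ne_zero⟩
  obtain ⟨s, hs, h⟩ := exists_sum_properGlue haut hp hpm i (FDiagram.ofMap Y id) N
    (fun ε => μ.toWeight.val Sum.inl ε) (fun ε _ => val_pullback_rot _ ε) hN
  refine ⟨s, hs, ?_⟩
  rw [← μ.toWeight_embedding i, ← μ.toWeight_isMeasure.sum_selfGlue, ← sum_properGlue, h,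
    nsmul_eq_mul]
  ring

theorem Measure.pow_eq_self [CharP R p] (μ : Measure F R) {X Y : F} (i : X.1 ↪[L] Y.1) :
    μ.val (X := X) (Y := Y) i ^ p = μ.val (X := X) (Y := Y) i := by
  obtain ⟨s, -, h⟩ := μ.exists_pow_sub_self haut hp hpm i ⊤ fun _ _ => trivial
  rw [CharP.cast_eq_zero, zero_mul] at h
  exact sub_eq_zero.1 h

end PrimePower

theorem mem_selfGlue_of_mem_properGlue {E D : Type w} [Finite E] [Finite D] {n : ℕ} {f : E → D}
    {δ : FDiagram F D} {ε : FDiagram F (E ⊕ Fin n × D)} (hε : ε ∈ properGlue n f δ) :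
    ε ∈ selfGlue n f δ := by
  classical exact Finset.mem_of_mem_erase hε

theorem selfGlue_pullback_inl {X Y : F} (i : X.1 ↪[L] Y.1) {p : ℕ}
    {ε : FDiagram F (X.1 ⊕ Fin p × Y.1)} (hε : ε ∈ selfGlue p i (FDiagram.ofMap Y id)) :
    ε.pullback Sum.inl = FDiagram.ofMap X id :=
  (mem_selfGlue.1 hε).1.trans (ofMap_pullback_embedding i)

/-- Each of the p copies adds at most one point to the common part. -/
theorem card_str_le_of_mem_selfGlue {Y : F} {y : Y.1} {p : ℕ}
    {ε : FDiagram F ((subObject Y {y}ᶜ).1 ⊕ Fin p × Y.1)}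
    (hε : ε ∈ selfGlue p (subObjectIncl Y {y}ᶜ) (FDiagram.ofMap Y id)) :
    Nat.card ε.str.1 ≤ p + Nat.card (subObject Y {y}ᶜ).1 := by
  have hsurj : Function.Surjective (Sum.elim (fun j : Fin p => ε.mk (Sum.inr (j, y)))
      fun x => ε.mk (Sum.inl x)) := by
    intro t
    obtain ⟨t, rfl⟩ := ε.mk_surjective t
    rcases t with x | ⟨j, x⟩
    · exact ⟨Sum.inr x, rfl⟩
    · by_cases hx : x = y
      · subst hx
        exact ⟨Sum.inl j, rfl⟩
      · exact ⟨Sum.inr ⟨x, hx⟩, ε.mk_eq_mk.2 ((mem_selfGlue.1 hε).2.2 j ⟨x, hx⟩)⟩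
  have := Nat.card_le_card_of_surjective _ hsurj
  rwa [Nat.card_sum, Nat.card_fin] at this

theorem finite_quotient_amalgamation {X Y Z : F} (i : X.1 ↪[L] Y.1) (j : X.1 ↪[L] Z.1) :
    Finite (Quotient (amalgamationSetoid F i j)) := by
  refine Finite.of_injective (β := FDiagram F (Y.1 ⊕ Z.1))
    (Quotient.lift (fun P : Amalgamation F i j => P.diagram id id) fun P Q h =>
      (Amalgamation.iso_iff_diagram_eq Function.surjective_id Function.surjective_id P Q).1 h) ?_
  intro P Q
  induction P using Quotient.inductionOn
  induction Q using Quotient.inductionOn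
  intro h
  exact Quotient.sound ((Amalgamation.iso_iff_diagram_eq Function.surjective_id
    Function.surjective_id _ _).2 h)

/-! ### Integrality of values at places above p -/

section Valuations

variable {K : Type z} [Field K] {Γ : Type*} [LinearOrderedCommGroupWithZero Γ]
  (w : Valuation K Γ)

/-- The elements of bounded valuation. -/
def Valuation.leSubmonoid (c : Γ) : AddSubmonoid K where
  carrier := {x | w x ≤ c}
  add_mem' hx hy := w.map_add_le hx hy
  zero_mem' := by simp

theorem valuation_list_prod_le {α : Type*} (f : α → K) {c : Γ} (l : List α)
    (h : ∀ x ∈ l, w (f x) ≤ c) : w (l.map f).prod ≤ c ^ l.length := by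
  induction l with
  | nil => simp
  | cons x l ih =>
    rw [List.map_cons, List.prod_cons, map_mul, List.length_cons, pow_succ']
    exact mul_le_mul' (h x List.mem_cons_self) (ih fun y hy => h y (List.mem_cons_of_mem _ hy))

theorem valuation_list_prod_sub_le {α : Type*} (f g : α → K) {c : Γ} (l : List α)
    (hf : ∀ x ∈ l, w (f x) ≤ 1) (hg : ∀ x ∈ l, w (g x) ≤ 1)
    (h : ∀ x ∈ l, w (f x - g x) ≤ c) : w ((l.map f).prod - (l.map g).prod) ≤ c := by
  induction l with
  | nil => simp
  | cons x l ih =>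
    have ih' := ih (fun y hy => hf y (List.mem_cons_of_mem _ hy))
      (fun y hy => hg y (List.mem_cons_of_mem _ hy)) (fun y hy => h y (List.mem_cons_of_mem _ hy))
    have hprod := valuation_list_prod_le w f l fun y hy => hf y (List.mem_cons_of_mem _ hy)
    rw [one_pow] at hprod
    have heq : ((x :: l).map f).prod - ((x :: l).map g).prod =
        (f x - g x) * (l.map f).prod + g x * ((l.map f).prod - (l.map g).prod) := by
      rw [List.map_cons, List.prod_cons, List.map_cons, List.prod_cons]
      ring
    rw [heq]
    refine w.map_add_le ?_ ?_
    · rw [map_mul]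
      exact (mul_le_mul' (h x List.mem_cons_self) hprod).trans_eq (mul_one c)
    · rw [map_mul]
      exact (mul_le_mul' (hg x List.mem_cons_self) ih').trans_eq (one_mul c)

variable {m p : ℕ} (haut : AutBounded F m) (hfin : FinitelyManyMinimal F) (hp : p.Prime)
  (hpm : ¬ p ∣ m) (hw : w p < 1)
include haut hfin hp hpm hw

/-- Let x be a value of largest size a on the finitely many one-point extensions, and suppose a > 1.
Terms of x^p - x are products of at most p such values, so the difference is p·s with s of size at
most a^p. Its size is then below a^p, yet x^p dominates x and gives size exactly a^p. -/
theorem Measure.valuation_le_one (μ : Measure F K) {X Y : F} (i : X.1 ↪[L] Y.1) :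
    w (μ.val (X := X) (Y := Y) i) ≤ 1 := by
  obtain ⟨S, hS, hfac⟩ := exists_finite_markedVal hfin K
  suffices h : ∀ M ∈ S, w (μ.markedVal M) ≤ 1 by
    obtain ⟨l, hl, -, hl'⟩ := hfac X Y i
    rw [hl' μ]
    simpa using valuation_list_prod_le w μ.markedVal l fun M hM => h M (hl M hM)
  by_contra! hcon
  obtain ⟨M₁, hM₁, hM₁'⟩ := hcon
  obtain ⟨M, hM, hmax⟩ := Set.exists_max_image S (fun M => w (μ.markedVal M)) hS ⟨M₁, hM₁⟩
  set a := w (μ.markedVal M) with ha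
  have ha1 : 1 < a := hM₁'.trans_le (hmax M₁ hM₁)
  obtain ⟨s, hs, h⟩ := μ.exists_pow_sub_self haut hp hpm (subObjectIncl M.str {M.point}ᶜ)
    (Valuation.leSubmonoid w (a ^ p)) fun ε hε => by
      have hε' := mem_selfGlue_of_mem_properGlue hε
      obtain ⟨k, hk⟩ := Measure.exists_val_eq (R := K) Sum.inl ε (selfGlue_pullback_inl _ hε')
      obtain ⟨l, hl, hlen, hl'⟩ := hfac _ _ k
      rw [hk μ, hl' μ]
      refine (valuation_list_prod_le w μ.markedVal l fun M hM => hmax M (hl M hM)).trans ?_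
      have := card_str_le_of_mem_selfGlue hε'
      exact pow_le_pow_right₀ ha1.le (by omega)
  have hlt : a < a ^ p := lt_self_pow₀ ha1 hp.one_lt
  have h1 : w (μ.markedVal M ^ p - μ.markedVal M) = a ^ p := by
    rw [w.map_sub_eq_of_lt_left, map_pow]
    rwa [map_pow]
  have h2 : w (μ.markedVal M ^ p - μ.markedVal M) < a ^ p := by
    have h3 : μ.markedVal M ^ p - μ.markedVal M = p * s := h
    rw [h3, map_mul]
    have hpos : 0 < a ^ p := (zero_lt_one.trans ha1).trans hlt
    calc w p * w s ≤ w p * a ^ p := mul_le_mul' le_rfl hs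
      _ < 1 * a ^ p := mul_lt_mul_of_pos_right hw hpos
      _ = a ^ p := one_mul _
  exact h2.ne h1

/-- The map from X into a gluing factors through the zeroth copy of Y, so every term of a^p - a is a
times an integral value. Division by a leaves an integral multiple of p. -/
theorem Measure.valuation_pow_sub_one_lt (μ : Measure F K) (hμ : μ.IsRegular) {X Y : F}
    (i : X.1 ↪[L] Y.1) : w (μ.val (X := X) (Y := Y) i ^ (p - 1) - 1) < 1 := by
  have : NeZero p := ⟨hp.ne_zero⟩
  set a := μ.val (X := X) (Y := Y) i with ha
  have ha0 : a ≠ 0 := (hμ i).ne_zero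
  obtain ⟨s, hs, h⟩ := μ.exists_pow_sub_self haut hp hpm i
    (Valuation.leSubmonoid w (w a)) fun ε hε => by
      have hε' := mem_selfGlue.1 (mem_selfGlue_of_mem_properGlue hε)
      have h1 : μ.toWeight.val Sum.inl ε = μ.toWeight.val (fun y => Sum.inr (0, y)) ε * a := by
        have := μ.toWeight_isMeasure.mul i (fun y => Sum.inr ((0 : Fin p), y)) ε
        rw [hε'.2.1, μ.toWeight_embedding] at this
        rw [ha, ← this]
        exact Weight.val_congr_map _ _ fun x => hε'.2.2 0 x
      have h2 : w (μ.toWeight.val (fun y => Sum.inr ((0 : Fin p), y)) ε) ≤ 1 := by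
        obtain ⟨k, hk⟩ := Measure.exists_val_eq (R := K) _ ε (hε'.2.1 0)
        rw [hk μ]
        exact μ.valuation_le_one w haut hfin hp hpm hw k
      change w _ ≤ _
      rw [h1, map_mul]
      exact (mul_le_mul' h2 le_rfl).trans_eq (one_mul _)
  have h1 : a ^ (p - 1) - 1 = p * (s / a) := by
    rw [mul_div_assoc', eq_div_iff ha0, ← h, sub_mul, ← pow_succ, Nat.sub_add_cancel hp.pos,
      one_mul]
  have h2 : w (s / a) ≤ 1 := by
    rw [map_div₀]
    exact div_le_one_of_le₀ hs zero_le
  rw [h1, map_mul]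
  exact (mul_le_mul' le_rfl h2).trans_lt (by rwa [mul_one])

theorem Measure.valuation_eq_one (μ : Measure F K) (hμ : μ.IsRegular) {X Y : F}
    (i : X.1 ↪[L] Y.1) : w (μ.val (X := X) (Y := Y) i) = 1 := by
  have h := w.map_one_add_of_lt (μ.valuation_pow_sub_one_lt w haut hfin hp hpm hw hμ i)
  rw [add_sub_cancel, map_pow] at h
  exact (pow_eq_one_iff_of_nonneg zero_le (Nat.sub_pos_of_lt hp.one_lt).ne').1 h

end Valuations

/-! ### Residue characteristic two: uniqueness and parity -/

section Two

variable {K : Type z} [Field K] {Γ : Type*} [LinearOrderedCommGroupWithZero Γ]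
  (w : Valuation K Γ) {m : ℕ} (haut : AutBounded F m) (hfin : FinitelyManyMinimal F)
  (hm : Odd m) (hw : w 2 < 1)
include haut hfin hm hw

theorem Measure.valuation_sub_one_lt (μ : Measure F K) (hμ : μ.IsRegular) {X Y : F}
    (i : X.1 ↪[L] Y.1) : w (μ.val (X := X) (Y := Y) i - 1) < 1 := by
  simpa using μ.valuation_pow_sub_one_lt w haut hfin Nat.prime_two hm.not_two_dvd_nat
    (by exact_mod_cast hw) hμ i

/-- In residue characteristic two a regular measure is unique. -/
theorem Measure.val_eq_of_isRegular (μ μ' : Measure F K) (hμ : μ.IsRegular) (hμ' : μ'.IsRegular)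
    {X Y : F} (i : X.1 ↪[L] Y.1) :
    μ.val (X := X) (Y := Y) i = μ'.val (X := X) (Y := Y) i := by
  have hw' : w ((2 : ℕ) : K) < 1 := by exact_mod_cast hw
  have hle (ν : Measure F K) {X Y : F} (i : X.1 ↪[L] Y.1) := 
    ν.valuation_le_one w haut hfin Nat.prime_two hm.not_two_dvd_nat hw' i
  obtain ⟨S, hS, hfac⟩ := exists_finite_markedVal hfin K
  suffices h : ∀ M ∈ S, μ.markedVal M = μ'.markedVal M by
    obtain ⟨l, hl, -, hl'⟩ := hfac X Y i
    rw [hl' μ, hl' μ', List.map_congr_left fun M hM => h M (hl M hM)]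
  rcases S.eq_empty_or_nonempty with rfl | hne
  · simp
  -- By telescoping products of integral values, the largest discrepancy `d` on one-point extensions
  -- bounds the discrepancy on all embeddings.
  obtain ⟨M, hM, hmax⟩ := Set.exists_max_image S
    (fun M => w (μ.markedVal M - μ'.markedVal M)) hS hne
  set d := w (μ.markedVal M - μ'.markedVal M) with hd
  suffices hd0 : d = 0 by
    intro N hN
    have := hmax N hN
    rw [hd0, le_zero_iff, Valuation.zero_iff] at this
    exact sub_eq_zero.1 this
  set j := subObjectIncl M.str {M.point}ᶜ
  have : NeZero 2 := ⟨two_ne_zero⟩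
  obtain ⟨s, hs, h⟩ := exists_sum_properGlue haut Nat.prime_two hm.not_two_dvd_nat j
    (FDiagram.ofMap M.str id) (Valuation.leSubmonoid w d)
    (fun ε => μ.toWeight.val Sum.inl ε - μ'.toWeight.val Sum.inl ε)
    (fun ε _ => by rw [val_pullback_rot, val_pullback_rot])
    (fun ε hε => by
      have hε' := mem_selfGlue_of_mem_properGlue hε
      obtain ⟨k, hk⟩ := Measure.exists_val_eq (R := K) Sum.inl ε (selfGlue_pullback_inl _ hε')
      obtain ⟨l, hl, -, hl'⟩ := hfac _ _ k
      rw [hk μ, hk μ', hl' μ, hl' μ']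
      exact valuation_list_prod_sub_le w _ _ l (fun N _ => hle μ _) (fun N _ => hle μ' _)
        fun N hN => hmax N (hl N hN))
  have hsum (ν : Measure F K) : ∑ ε ∈ properGlue 2 j (FDiagram.ofMap M.str id),
      ν.toWeight.val Sum.inl ε = ν.markedVal M ^ 2 - ν.markedVal M := by
    rw [eq_sub_iff_add_eq]
    have h1 := sum_properGlue (n := 2) ν.toWeight j (FDiagram.ofMap M.str id)
    rw [ν.toWeight_isMeasure.sum_selfGlue, ν.toWeight_embedding] at h1
    exact h1
  rw [Finset.sum_sub_distrib, hsum, hsum, nsmul_eq_mul] at h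
  set a := μ.markedVal M with ha
  set b := μ'.markedVal M with hb
  -- The difference of a² - a and b² - b is (a - b)(a + b - 1), and the second factor is a unit
  -- since a ≡ b ≡ 1. Hence `d` is at most `w 2 * d`, which forces `d = 0`.
  have hfactor : (a - b) * (1 + ((a - 1) + (b - 1))) = 2 * s := by
    rw [Nat.cast_ofNat] at h
    rw [← h]
    ring
  have hunit : w (1 + ((a - 1) + (b - 1))) = 1 :=
    w.map_one_add_of_lt (w.map_add_lt (μ.valuation_sub_one_lt w haut hfin hm hw hμ j)
      (μ'.valuation_sub_one_lt w haut hfin hm hw hμ' j))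
  have hfin' := congrArg w hfactor
  rw [map_mul, hunit, mul_one, map_mul] at hfin'
  by_contra hd0
  have : d < d := calc
    d = w 2 * w s := hfin'
    _ ≤ w 2 * d := mul_le_mul' le_rfl hs
    _ < 1 * d := mul_lt_mul_of_pos_right hw (zero_lt_iff.2 hd0)
    _ = d := one_mul d
  exact this.false

/-- All values are ≡ 1 modulo the maximal ideal, where 2 vanishes, so the amalgamation axiom reduces
to 1 ≡ n for the number n of amalgamations. -/
theorem Measure.isOddClass_of_isRegular (μ : Measure F K) (hμ : μ.IsRegular) : IsOddClass F := by
  intro X Y Z i j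
  have := finite_quotient_amalgamation i j
  obtain ⟨n, ⟨e⟩⟩ := Finite.exists_equiv_fin (Quotient (amalgamationSetoid F i j))
  have h := μ.val_amalgamation i j _ (fun n => (e.symm n).out) fun B => by
    refine ⟨e (Quotient.mk _ B), ?_, fun n hn => ?_⟩
    · refine Quotient.exact (s := amalgamationSetoid F i j) ?_
      rw [Quotient.out_eq, e.symm_apply_apply]
    · rw [← e.symm_apply_eq, ← Quotient.out_eq (e.symm n)]
      exact (Quotient.sound (s := amalgamationSetoid F i j) hn).symm
  rw [numAmalgamations, Nat.card_eq_of_equiv_fin e]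
  by_contra hodd
  obtain ⟨k, hk⟩ := Nat.not_odd_iff_even.1 hodd
  have h1 : w ((n : K) - μ.val (X := X) (Y := Y) i) < 1 := by
    rw [h, Valuation.map_sub_swap]
    have : ∑ α, μ.val (X := Z) (Y := (e.symm α).out.pt) (e.symm α).out.inr - (n : K) =
        ∑ α, (μ.val (X := Z) (Y := (e.symm α).out.pt) (e.symm α).out.inr - 1) := by
      simp
    rw [this]
    exact w.map_sum_lt one_ne_zero fun α _ => μ.valuation_sub_one_lt w haut hfin hm hw hμ _
  have h2 : w (n : K) < 1 := by
    have hk' : (n : K) = 2 * k := by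
      rw [hk]
      push_cast
      ring
    have hkle : w (k : K) ≤ 1 := by
      have := w.map_sum_le (s := Finset.range k) (f := fun _ => (1 : K)) (g := 1) (by simp)
      simpa using this
    rw [hk', map_mul]
    exact (mul_le_mul' le_rfl hkle).trans_lt (by rwa [mul_one])
  have h3 := μ.valuation_sub_one_lt w haut hfin hm hw hμ i
  have h4 := w.map_sub_lt h2 (w.map_add_lt h1 h3)
  simp at h4

end Two

end FraisseMeasure

namespace FraisseMeasure

open FirstOrder.Language FirstOrder.Language.Structure

variable {L : FirstOrder.Language.{u, v}} [L.IsRelational]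
  {F : Set (CategoryTheory.Bundled.{w} L.Structure)} [hF : Fact (IsFraisseClass F)]

/-! ### Places of fields of characteristic zero -/

section Fields

/-- In characteristic zero p generates a proper ideal of the image of ℤ, and proper ideals of
subrings lie in the nonunits of some valuation ring. -/
theorem exists_valuationSubring_natCast_lt_one (K : Type*) [Field K] [CharZero K] {p : ℕ}
    (hp : p.Prime) : ∃ O : ValuationSubring K, O.valuation (p : K) < 1 := by
  let A : Subring K := (Int.castRingHom K).range
  obtain ⟨O, -, hO⟩ := Ideal.image_subset_nonunits_valuationSubring (K := K) (A := A)
    (Ideal.span {(p : A)}) (by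
      rw [Ne, Ideal.span_singleton_eq_top]
      intro h
      obtain ⟨⟨_, n, rfl⟩, hn⟩ := h.exists_right_inv
      have h1 := congrArg Subtype.val hn
      have h2 : ((p * n : ℤ) : K) = ((1 : ℤ) : K) := by
        push_cast
        simpa using h1
      have h3 : (p : ℤ) ∣ 1 := ⟨n, (Int.cast_injective h2).symm⟩
      exact hp.one_lt.ne' (by exact_mod_cast Int.eq_one_of_dvd_one (by positivity) h3))
  refine ⟨O, ?_⟩
  rw [← ValuationSubring.mem_nonunits_iff]
  exact hO ⟨(p : A), Ideal.subset_span rfl, by simp⟩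

/-- An element that is integral at all places above two is algebraic. -/
theorem isAlgebraic_of_forall_valuation_le_one {K : Type*} [Field K] [CharZero K] {x : K}
    (hx : x ≠ 0)
    (h : ∀ O : ValuationSubring K, O.valuation (2 : K) < 1 → O.valuation x ≤ 1) :
    IsAlgebraic ℚ x := by
  let A : Subring K := (Polynomial.aeval (R := ℤ) x⁻¹).toRingHom.range
  have hxA : x⁻¹ ∈ A := ⟨Polynomial.X, by simp⟩
  -- Otherwise some place has both 2 and x⁻¹ in its maximal ideal, and x is not integral there.
  have htop : Ideal.span {(2 : A), ⟨x⁻¹, hxA⟩} = ⊤ := by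
    by_contra hne
    obtain ⟨O, -, hO⟩ := Ideal.image_subset_nonunits_valuationSubring (K := K) (A := A) _ hne
    have h2 : O.valuation (2 : K) < 1 :=
      O.mem_nonunits_iff.1 (hO ⟨2, Ideal.subset_span (by simp), rfl⟩)
    have h3 : O.valuation x⁻¹ < 1 :=
      O.mem_nonunits_iff.1 (hO ⟨⟨x⁻¹, hxA⟩, Ideal.subset_span (by simp), rfl⟩)
    have h4 := h O h2
    have h5 : O.valuation (x * x⁻¹) < 1 := by
      rw [map_mul]
      exact (mul_le_mul' h4 le_rfl).trans_lt (by rwa [one_mul])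
    rw [mul_inv_cancel₀ hx, map_one] at h5
    exact h5.false
  rw [Ideal.eq_top_iff_one, Ideal.mem_span_pair] at htop
  obtain ⟨⟨_, a, rfl⟩, ⟨_, b, rfl⟩, hab⟩ := htop
  have hab' := congrArg Subtype.val hab
  have halg : IsAlgebraic ℤ x⁻¹ := by
    -- The constant coefficient is odd, so the polynomial is nonzero.
    refine ⟨a * 2 + b * Polynomial.X - 1, fun h0 => ?_, ?_⟩
    · have h1 := congrArg (fun q : Polynomial ℤ => q.coeff 0) h0
      simp only [Polynomial.coeff_sub, Polynomial.coeff_add, Polynomial.coeff_mul_X_zero,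
        Polynomial.coeff_zero, Polynomial.coeff_one_zero, Polynomial.coeff_mul_ofNat] at h1
      omega
    · rw [map_sub, map_add, map_mul, map_mul, map_one, Polynomial.aeval_X, map_ofNat]
      exact sub_eq_zero.2 hab'
  have := halg.inv
  rw [inv_inv] at this
  exact (IsFractionRing.isAlgebraic_iff ℤ ℚ K).1 (by convert this)

theorem exists_dvd_pow_of_forall_prime_dvd {m d : ℕ} (hd : d ≠ 0)
    (h : ∀ p : ℕ, p.Prime → p ∣ d → p ∣ m) : ∃ e : ℕ, d ∣ m ^ e := by
  induction d using induction_on_primes with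
  | zero => exact absurd rfl hd
  | one => exact ⟨0, by simp⟩
  | prime_mul p a hp ih =>
    obtain ⟨e, he⟩ := ih (by rintro rfl; simp at hd) fun q hq hqa => h q hq (hqa.mul_left p)
    refine ⟨e + 1, ?_⟩
    rw [pow_succ']
    exact mul_dvd_mul (h p hp (dvd_mul_right p a)) he

theorem exists_mem_range_away {m : ℕ} (hm : m ≠ 0) (x : ℚ)
    (ψ : Localization.Away (m : ℤ) →+* ℚ) (h : ∀ p : ℕ, p.Prime → p ∣ x.den → p ∣ m) :
    ∃ r, ψ r = x := by
  obtain ⟨e, c, hc⟩ := exists_dvd_pow_of_forall_prime_dvd x.den_nz h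
  refine ⟨IsLocalization.mk' _ (x.num * c) (⟨(m : ℤ) ^ e, e, rfl⟩ : Submonoid.powers (m : ℤ)), ?_⟩
  have h1 := congrArg ψ (IsLocalization.mk'_spec (Localization.Away (m : ℤ)) (x.num * c)
    (⟨(m : ℤ) ^ e, e, rfl⟩ : Submonoid.powers (m : ℤ)))
  rw [map_mul] at h1
  simp only [eq_intCast, map_intCast] at h1
  push_cast at h1
  have hm' : (m : ℚ) ^ e ≠ 0 := pow_ne_zero _ (by exact_mod_cast hm)
  refine mul_right_cancel₀ hm' (h1.trans ?_)
  have h2 : (m : ℚ) ^ e = x.den * c := by exact_mod_cast hc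
  rw [h2, ← mul_assoc, Rat.mul_den_eq_num]

/-- On integers, valuation below 1 means divisibility by p. Numerator and denominator of a unit have
equal valuation, so p divides both or neither, and they are coprime. -/
theorem not_dvd_num_and_den {p : ℕ} (hp : p.Prime) {x : ℚ} (O : ValuationSubring ℚ)
    (hO : O.valuation (p : ℚ) < 1) (hx : O.valuation x = 1) : ¬ p ∣ x.den ∧ ¬ (p : ℤ) ∣ x.num := by
  have hint (n : ℤ) : O.valuation (n : ℚ) ≤ 1 := by
    rw [ValuationSubring.valuation_le_one_iff]
    exact intCast_mem O n
  have hdvd (n : ℤ) : O.valuation (n : ℚ) < 1 ↔ (p : ℤ) ∣ n := by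
    constructor
    · intro hn
      by_contra hpn
      obtain ⟨a, b, hab⟩ := ((Nat.prime_iff_prime_int.1 hp).coprime_iff_not_dvd).2 hpn
      have h1 : (a : ℚ) * p + b * n = 1 := by exact_mod_cast hab
      have h2 : O.valuation ((a : ℚ) * p + b * n) < 1 := by
        refine O.valuation.map_add_lt ?_ ?_
        · rw [map_mul]
          exact (mul_le_mul' (hint a) le_rfl).trans_lt (by rwa [one_mul])
        · rw [map_mul]
          exact (mul_le_mul' (hint b) le_rfl).trans_lt (by rwa [one_mul])
      rw [h1, map_one] at h2
      exact h2.false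
    · rintro ⟨c, rfl⟩
      push_cast
      rw [map_mul]
      exact (mul_le_mul' le_rfl (hint c)).trans_lt (by rwa [mul_one])
  have heq : O.valuation (x.den : ℤ) = O.valuation (x.num : ℤ) := by
    have h1 : x * ((x.den : ℤ) : ℚ) = (x.num : ℤ) := by
      push_cast
      exact Rat.mul_den_eq_num x
    have h2 := congrArg O.valuation h1
    rwa [map_mul, hx, one_mul] at h2
  have hcop : ¬ ((p : ℤ) ∣ x.den ∧ (p : ℤ) ∣ x.num) := by
    rintro ⟨h1, h2⟩
    have h3 := Nat.dvd_gcd (Int.natCast_dvd.1 h2) (Int.natCast_dvd_natCast.1 h1)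
    rw [x.reduced] at h3
    exact hp.one_lt.ne' (Nat.dvd_one.1 h3)
  have hiff : (p : ℤ) ∣ x.den ↔ (p : ℤ) ∣ x.num := by
    rw [← hdvd, ← hdvd, heq]
  refine ⟨fun h => ?_, fun h => hcop ⟨hiff.2 h, h⟩⟩
  have h' : (p : ℤ) ∣ x.den := Int.natCast_dvd_natCast.2 h
  exact hcop ⟨h', hiff.1 h'⟩

end Fields

/-! ### Oddness from regular measures, and descent to ℚ and ℤ[1/m] -/

theorem Measure.IsRegular.map {R S : Type*} [CommRing R] [CommRing S] {μ : Measure F R}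
    (hμ : μ.IsRegular) (φ : R →+* S) : (μ.map φ).IsRegular :=
  fun i => (hμ i).map φ

/-- Over an odd class the constant function one is a measure modulo two. -/
theorem IsOddClass.exists_measure (h : IsOddClass F) :
    ∃ μ : Measure F (ZMod 2), μ.IsRegular := by
  refine ⟨{ val := fun _ => 1
            val_iso := fun _ => rfl
            val_comp := fun _ _ => (mul_one _).symm
            val_amalgamation := fun {X Y X'} i j n A hA => ?_ }, fun _ => isUnit_one⟩
  have hbij : Function.Bijective fun k : Fin n =>
      (Quotient.mk (amalgamationSetoid F i j) (A k)) := by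
    constructor
    · intro k k' hk
      exact (hA (A k)).unique (Amalgamation.iso_equivalence.refl _) (Quotient.exact hk)
    · intro q
      induction q using Quotient.inductionOn with
      | h B =>
        obtain ⟨k, hk, -⟩ := hA B
        exact ⟨k, (Quotient.sound hk).symm⟩
  have hn : Odd n := by
    have h1 := h X Y X' i j
    rwa [numAmalgamations, ← Nat.card_eq_of_bijective _ hbij, Nat.card_fin] at h1
  simp [ZMod.natCast_eq_one_iff_odd.2 hn]

variable {m : ℕ} (hfin : FinitelyManyMinimal F) (hm : Odd m) (haut : AutBounded F m)
include hfin hm haut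

/-- A class with a regular measure valued in a field of characteristic zero is odd. -/
theorem Measure.isOddClass_of_charZero {K : Type*} [Field K] [CharZero K] (μ : Measure F K)
    (hμ : μ.IsRegular) : IsOddClass F := by
  obtain ⟨O, hO⟩ := exists_valuationSubring_natCast_lt_one K Nat.prime_two
  exact μ.isOddClass_of_isRegular O.valuation haut hfin hm (by exact_mod_cast hO) hμ

/-- A class with a regular measure valued in a field where `m` is invertible is odd. -/
theorem Measure.isOddClass {K : Type z} [Field K] (hmK : (m : K) ≠ 0) (μ : Measure F K)
    (hμ : μ.IsRegular) : IsOddClass F := by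
  obtain ⟨p, hchar⟩ := CharP.exists K
  rcases CharP.char_is_prime_or_zero K p with hp | rfl
  · have : Fact p.Prime := ⟨hp⟩
    have hpm : ¬ p ∣ m := fun h => hmK ((CharP.cast_eq_zero_iff K p m).2 h)
    let φ : ZMod p →+* K := ZMod.castHom (m := p) dvd_rfl K
    obtain ⟨μ', hμ'⟩ := μ.exists_of_injective φ φ.injective fun X Y i => by
      have h1 := μ.pow_eq_self haut hp hpm i
      -- The roots of a^p = a in characteristic p form the prime field.
      rw [← Subfield.mem_bot_iff_pow_eq_self K p, ← ZMod.fieldRange_castHom_eq_bot p] at h1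
      exact h1
    have hreg : μ'.IsRegular := fun {X Y} i => by
      rw [isUnit_iff_ne_zero]
      intro h0
      have := hμ' X Y i
      rw [h0, map_zero] at this
      exact (hμ i).ne_zero this.symm
    obtain ⟨ν, hν⟩ := μ'.exists_isRegular_padic haut hpm hreg
    exact ν.isOddClass_of_charZero hfin hm haut hν
  · have : CharZero K := CharP.charP_to_charZero K
    exact μ.isOddClass_of_charZero hfin hm haut hμ

/-- A regular measure with algebraic values descends to the base field. -/
theorem Measure.exists_isRegular_of_isAlgebraic {K E : Type*} [Field K] [CharZero K] [Field E]
    [Algebra K E] (μ : Measure F E) (hμ : μ.IsRegular)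
    (halg : ∀ {X Y : F} (i : X.1 ↪[L] Y.1), IsAlgebraic K (μ.val i)) :
    ∃ ν : Measure F K, ν.IsRegular := by
  let A := algebraicClosure K E
  obtain ⟨μA, hμA⟩ := μ.exists_of_injective (algebraMap A E) (algebraMap A E).injective
    fun X Y i => ⟨⟨_, mem_algebraicClosure_iff.2 (halg i)⟩, rfl⟩
  have hμAreg : μA.IsRegular := fun {X Y} i => by
    rw [isUnit_iff_ne_zero]
    intro h0
    have := hμA X Y i
    rw [h0, map_zero] at this
    exact (hμ i).ne_zero this.symm
  let C := AlgebraicClosure K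
  have : CharZero C := charZero_of_injective_algebraMap (algebraMap K C).injective
  have : Algebra.IsAlgebraic K A := algebraicClosure.isAlgebraic K E
  have : IsGalois K C := IsAlgClosure.isGalois K C
  -- The values are moved into an algebraic closure of `K`, which is Galois over `K`, so that
  -- descent becomes invariance.
  let φ : A →ₐ[K] C := IsAlgClosed.lift
  let μ' := μA.map φ.toRingHom
  have hμ' : μ'.IsRegular := hμAreg.map _
  obtain ⟨O, hO⟩ := exists_valuationSubring_natCast_lt_one C Nat.prime_two
  obtain ⟨ν, hν⟩ := μ'.exists_of_injective (algebraMap K C) (algebraMap K C).injective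
    fun X Y i => by
      have : μ'.val (X := X) (Y := Y) i ∈ Set.range (algebraMap K C) := by
        rw [InfiniteGalois.mem_range_algebraMap_iff_fixed]
        intro σ
        -- A conjugate of a regular measure is again regular, and uniqueness with respect to one
        -- fixed place above 2 identifies it with the original; the place need not be invariant
        -- under σ.
        exact (μ'.map σ.toRingEquiv.toRingHom).val_eq_of_isRegular O.valuation haut hfin hm
          (by exact_mod_cast hO) μ' (hμ'.map _) hμ' i
      exact this
  refine ⟨ν, fun {X Y} i => ?_⟩
  rw [isUnit_iff_ne_zero]
  intro h0
  have := hν X Y i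
  rw [h0, map_zero] at this
  exact (hμ' i).ne_zero this.symm

/-- An odd class admits a regular measure valued in the rational numbers. -/
theorem IsOddClass.exists_measure_rat (h : IsOddClass F) :
    ∃ μ : Measure F ℚ, μ.IsRegular := by
  obtain ⟨μ₂, hμ₂⟩ := h.exists_measure
  have : Fact (Nat.Prime 2) := ⟨Nat.prime_two⟩
  obtain ⟨μ, hμ⟩ := μ₂.exists_isRegular_padic haut hm.not_two_dvd_nat hμ₂
  exact μ.exists_isRegular_of_isAlgebraic hfin hm haut hμ fun i =>
    isAlgebraic_of_forall_valuation_le_one (hμ i).ne_zero fun O hO =>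
      μ.valuation_le_one O.valuation haut hfin Nat.prime_two hm.not_two_dvd_nat
        (by exact_mod_cast hO) i

/-- An odd class admits a regular measure valued in any ring where `m` is invertible. -/
theorem IsOddClass.exists_measure_of_isUnit {k : Type z} [CommRing k] (hk : IsUnit (m : k))
    (h : IsOddClass F) : ∃ μ : Measure F k, μ.IsRegular := by
  obtain ⟨μ, hμ⟩ := h.exists_measure_rat hfin hm haut
  have hm0 : m ≠ 0 := hm.pos.ne'
  have hmQ : IsUnit (Int.castRingHom ℚ (m : ℤ)) := by
    rw [isUnit_iff_ne_zero]
    simpa using hm0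
  let ψ : Localization.Away (m : ℤ) →+* ℚ := IsLocalization.Away.lift (m : ℤ) hmQ
  have hψ : Function.Injective ψ := by
    refine (IsLocalization.lift_injective_iff _).2 fun a b => ?_
    rw [(IsLocalization.injective (M := Submonoid.powers (m : ℤ)) (Localization.Away (m : ℤ))
      (powers_le_nonZeroDivisors_of_noZeroDivisors
        (by exact_mod_cast hm0 : (m : ℤ) ≠ 0))).eq_iff]
    simp
  -- Values are units at every prime not dividing m, so numerators and denominators have only prime
  -- factors of m; both the values and their inverses then lie in ℤ[1/m].
  have hprime (p : ℕ) (hp : p.Prime) (hpm : ¬ p ∣ m) {X Y : F} (i : X.1 ↪[L] Y.1) :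
      ¬ p ∣ (μ.val (X := X) (Y := Y) i).den ∧ ¬ (p : ℤ) ∣ (μ.val (X := X) (Y := Y) i).num := by
    obtain ⟨O, hO⟩ := exists_valuationSubring_natCast_lt_one ℚ hp
    exact not_dvd_num_and_den hp O hO (μ.valuation_eq_one O.valuation haut hfin hp hpm hO hμ i)
  obtain ⟨μ', hμ'⟩ := μ.exists_of_injective ψ hψ fun X Y i =>
    exists_mem_range_away hm0 _ ψ fun p hp hpd => by
      by_contra hpm
      exact (hprime p hp hpm i).1 hpd
  have hreg : μ'.IsRegular := fun {X Y} i => by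
    obtain ⟨r, hr⟩ := exists_mem_range_away hm0 (μ.val (X := X) (Y := Y) i)⁻¹ ψ
      fun p hp hpd => by
        by_contra hpm
        refine (hprime p hp hpm i).2 ?_
        rw [Rat.den_inv_of_ne_zero (hμ i).ne_zero] at hpd
        exact Int.natCast_dvd.2 hpd
    refine IsUnit.of_mul_eq_one r (hψ ?_)
    rw [map_mul, map_one, hμ', hr, mul_inv_cancel₀ (hμ i).ne_zero]
  have hk' : IsUnit (Int.castRingHom k (m : ℤ)) := by simpa using hk
  exact ⟨μ'.map (IsLocalization.Away.lift (m : ℤ) hk'), hreg.map _⟩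

end FraisseMeasure

theorem theorem1p2 {L : FirstOrder.Language.{u, v}} [L.IsRelational]
    (F : Set (CategoryTheory.Bundled.{w} L.Structure))
    (hF : FraisseMeasure.IsFraisseClass F)
    (hfin : FraisseMeasure.FinitelyManyMinimal F)
    (m : ℕ) (hm : Odd m) (haut : FraisseMeasure.AutBounded F m)
    (k : Type z) [CommRing k] [Nontrivial k] (hk : IsUnit (m : k)) :
    (∃ μ : FraisseMeasure.Measure F k, μ.IsRegular) ↔ FraisseMeasure.IsOddClass F := by
  have : Fact (FraisseMeasure.IsFraisseClass F) := ⟨hF⟩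
  constructor
  · rintro ⟨μ, hμ⟩
    -- Regular measures survive reduction to a residue field, and m stays nonzero there because it
    -- is a unit of `k`.
    obtain ⟨M, hM⟩ := Ideal.exists_maximal k
    let _ : Field (k ⧸ M) := Ideal.Quotient.field M
    refine FraisseMeasure.Measure.isOddClass hfin hm haut (K := k ⧸ M) ?_
      (μ.map (Ideal.Quotient.mk M)) (hμ.map _)
    simpa using (hk.map (Ideal.Quotient.mk M)).ne_zero
  · exact fun h => h.exists_measure_of_isUnit hfin hm haut hk
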